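/- Let $d\ge 1$ be an integer and let $\mathbb{T}^d=\mathbb{R}^d/\mathbb{Z}^d$ carry the metric $\|x-y\|=\min_{z\in\mathbb{Z}^d}|x-y-z|_\infty$, where $|\cdot|_\infty$ is the maximum norm on $\mathbb{R}^d$. Let $(\omega_n)_{n\ge1}$ be a sequence of independent random variables on a probability space, each uniformly distributed on $\mathbb{T}^d$ with respect to Lebesgue measure. For $c>0$ put $\ell_n=c/n^{1/d}$ $(n\ge1)$ and define the uniform random covering set $$\mathcal{U}=\big\{y\in\mathbb{T}^d:\ \text{for all sufficiently large } N \text{ there is } 1\le n\le N \text{ with } \|\omega_n-y\|<\ell_N\big\}.$$ Then: 1. if $c>\tfrac12$, then $\dim_{\mathrm H}\mathcal{U}>0$ almost surely; 2. if $0<c<\tfrac12$, then $\dim_{\mathrm H}\mathcal{U}<d$ almost surely, where $\dim_{\mathrm H}$ denotes Hausdorff dimension. -/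

import Mathlib

open MeasureTheory ProbabilityTheory Filter

/-- The uniform random covering set of a sequence of centres `x 1, x 2, …` in a metric space and of
radii `r 1, r 2, …`: the points `y` such that for all sufficiently large `N` there is
`1 ≤ n ≤ N` with `dist (x n) y < r N`. -/
def uniformCoveringSet {X : Type*} [MetricSpace X] (x : ℕ+ → X) (r : ℕ+ → ℝ) : Set X :=
  {y | ∀ᶠ N : ℕ+ in atTop, ∃ n : ℕ+, n ≤ N ∧ dist (x n) y < r N}

/-! Put `B = b ^ d`. Only the times `N = B ^ j` matter, up to the choice of radius between two of
them, and a small change of `c` lets centres of grid cells stand in for arbitrary points. Let `κ =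
(2 * c) ^ d` for the changed `c`. The sequence of centres is cut into independent blocks `B ^ (i -
1) < n ≤ B ^ i`.

Case `c < 1 / 2`. If `x` is covered at time `B ^ k`, the covering point lies in some block `i ≤ k`.
Survival of `x` up to `i` involves earlier points only, and block `i` hits with probability at most
`κ * B ^ i / B ^ k`. The resulting recursion bounds the survival probability by a multiple of `θ ^
k` with `θ = κ + 1 / B`, which is less than 1 for large `b` (`measure_surviveEvent_le`). A
first-moment count of surviving cells and Fatou's lemma then give dimension at most some `s < d`
(`ae_dimH_le_of_surviveEvent`).

Case `c > 1 / 2`. Ask for more: a cell of level `j` must be hit by block `j` alone, with the smaller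
radius belonging to `B ^ (j + 1)`. For `κ > 1` and `b` large this has probability above `1 / B`, so
a cell keeps more than one of its `B` children on average. Misses of distant cells are not
positively correlated, and Chebyshev makes a drop below the expected growth unlikely, in inverse
proportion to the number of cells (`measureReal_cellTree_drop_le`). This beats a union bound over
binary words: in every `g`-th generation the position is dictated by a letter, and almost surely,
from some starting level on, the trees of all words survive together
(`measure_exists_cellTree_eq_empty_le`). Limit points of different words are separated, so the set
of them has a Hölder map onto `[0, 1]` and positive dimension (`dimH_range_pos_of_separated`). -/

/-- The centre of the cell with index `v` in the partition of the torus into `N ^ d` cubes. -/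
noncomputable def gridPoint {d : ℕ} (N : ℕ) (v : Fin d → ℕ) : UnitAddTorus (Fin d) :=
  fun i => ((((v i : ℝ) + 1 / 2) / N : ℝ) : UnitAddCircle)

/-- The indices of the cells in the partition of the torus into `N ^ d` cubes. -/
def gridIndex (d N : ℕ) : Finset (Fin d → ℕ) := Fintype.piFinset fun _ => Finset.range N

lemma mem_gridIndex {d N : ℕ} {v : Fin d → ℕ} : v ∈ gridIndex d N ↔ ∀ i, v i < N := by
  simp [gridIndex]

lemma card_gridIndex (d N : ℕ) : (gridIndex d N).card = N ^ d := by
  simp [gridIndex]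

/-! ### Distances and volumes on the torus grid. -/

lemma le_norm_intCast_div {N m : ℕ} (hN : 0 < N) {k : ℤ}
    (h : ∀ z : ℤ, (m : ℤ) ≤ |k - N * z|) :
    (m : ℝ) / N ≤ ‖((k / N : ℝ) : UnitAddCircle)‖ := by
  rw [UnitAddCircle.norm_eq]
  have hN' : (0 : ℝ) < N := by exact_mod_cast hN
  rw [div_le_iff₀ hN', ← abs_of_pos hN', ← abs_mul, abs_of_pos hN', sub_mul,
    div_mul_cancel₀ _ hN'.ne']
  have := h (round ((k : ℝ) / N))
  rw [mul_comm (round ((k : ℝ) / N) : ℝ)]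
  generalize round ((k : ℝ) / N) = z at this ⊢
  exact_mod_cast this

instance isProbabilityMeasure_volume_unitAddTorus {d : ℕ} :
    IsProbabilityMeasure (volume : Measure (UnitAddTorus (Fin d))) := by
  have : IsProbabilityMeasure (volume : Measure UnitAddCircle) := ⟨by
    rw [AddCircle.measure_univ, ENNReal.ofReal_one]⟩
  exact inferInstanceAs (IsProbabilityMeasure (Measure.pi fun _ => volume))

lemma volume_ball_unitAddTorus {d : ℕ} (x : UnitAddTorus (Fin d)) {r : ℝ} (hr : 0 < r)
    (hr2 : r ≤ 1 / 2) : volume (Metric.ball x r) = ENNReal.ofReal ((2 * r) ^ d) := by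
  rw [volume_pi_ball _ hr]
  have : ∀ i, volume (Metric.ball (x i) r) = ENNReal.ofReal (2 * r) := fun i => by
    rw [← measure_congr (AddCircle.closedBall_ae_eq_ball (x := x i) (ε := r)),
      AddCircle.volume_closedBall, min_eq_right (by linarith)]
  simp only [this, Finset.prod_const, Finset.card_univ, Fintype.card_fin]
  rw [ENNReal.ofReal_pow (by positivity)]

lemma volume_ball_unitAddTorus_le {d : ℕ} (x : UnitAddTorus (Fin d)) {r : ℝ} (hr : 0 < r) :
    volume (Metric.ball x r) ≤ ENNReal.ofReal ((2 * r) ^ d) := by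
  rcases le_total r (1 / 2) with h | h
  · exact (volume_ball_unitAddTorus x hr h).le
  · refine prob_le_one.trans ?_
    rw [← ENNReal.ofReal_one]
    exact ENNReal.ofReal_le_ofReal (one_le_pow₀ (by linarith))

lemma le_dist_gridPoint {d N : ℕ} {v w : Fin d → ℕ} (hv : v ∈ gridIndex d N)
    (hw : w ∈ gridIndex d N) (hvw : v ≠ w) :
    1 / (N : ℝ) ≤ dist (gridPoint N v) (gridPoint N w) := by
  rw [mem_gridIndex] at hv hw
  obtain ⟨i, hi⟩ := Function.ne_iff.1 hvw
  refine le_trans ?_ (dist_le_pi_dist _ _ i)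
  have hN : 0 < N := (Nat.zero_le _).trans_lt (hv i)
  have := le_norm_intCast_div (m := 1) hN (k := (v i : ℤ) - w i) (fun z => by
    have h1 := hv i
    have h2 := hw i
    rw [Nat.cast_one]
    refine Int.one_le_abs fun h0 => hi ?_
    have : ((v i : ℤ)) - w i = N * z := by linarith
    have hz : z = 0 := by
      by_contra hz
      have : (N : ℤ) ≤ |(v i : ℤ) - w i| := by
        rw [this, abs_mul, Nat.abs_cast]
        nlinarith [Int.one_le_abs hz]
      rw [le_abs] at this
      omega
    subst hz
    omega)
  rw [dist_eq_norm]
  refine (le_of_eq ?_).trans (this.trans (le_of_eq ?_))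
  · simp
  · simp only [gridPoint, ← AddCircle.coe_sub]
    congr 2
    push_cast
    ring

lemma exists_dist_gridPoint_le {d N : ℕ} (hN : 0 < N) (x : UnitAddTorus (Fin d)) :
    ∃ v ∈ gridIndex d N, dist x (gridPoint N v) ≤ 1 / (2 * N) := by
  have hN' : (0 : ℝ) < N := by exact_mod_cast hN
  have key : ∀ i, ∃ k < N, dist (x i) ((((k : ℝ) + 1 / 2) / N : ℝ) : UnitAddCircle) ≤
      1 / (2 * N) := fun i => by
    obtain ⟨t, ht, hx⟩ : ∃ t ∈ Set.Ico (0 : ℝ) 1, ((t : ℝ) : UnitAddCircle) = x i := by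
      have := AddCircle.coe_image_Ico_eq (1 : ℝ) 0
      have hx : x i ∈ (Set.univ : Set (AddCircle (1 : ℝ))) := trivial
      rw [← this] at hx
      simpa using hx
    have h0 : 0 ≤ t * N := mul_nonneg ht.1 hN'.le
    refine ⟨⌊t * N⌋₊, ?_, ?_⟩
    · rw [Nat.floor_lt h0]
      nlinarith [ht.2]
    · rw [← hx, dist_eq_norm, ← AddCircle.coe_sub]
      refine (QuotientAddGroup.norm_mk_le_norm).trans ?_
      have h1 := Nat.floor_le h0
      have h2 := Nat.lt_floor_add_one (t * N)
      rw [Real.norm_eq_abs, abs_le]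
      constructor
      · rw [neg_le_sub_iff_le_add, div_le_iff₀ hN']
        field_simp
        linarith
      · rw [sub_le_iff_le_add]
        field_simp
        linarith
  choose v hv hd using key
  refine ⟨v, mem_gridIndex.2 hv, (dist_pi_le_iff (by positivity)).2 hd⟩

/-- The bound is the difference of the radii of parent and child, so the closed cube of a child lies
in that of its parent. -/
lemma dist_gridPoint_child_le {d N b : ℕ} (hN : 0 < N) {u : Fin d → ℕ} (v : Fin d → ℕ)
    (hb : 0 < b) (hu : ∀ i, u i < b) :
    dist (gridPoint (b * N) (b • v + u)) (gridPoint N v) ≤ 1 / (2 * N) - 1 / (2 * (b * N : ℕ)) := by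
  have hN' : (0 : ℝ) < N := by exact_mod_cast hN
  have hb' : (1 : ℝ) ≤ b := by exact_mod_cast hb
  have h0 : (0 : ℝ) ≤ 1 / (2 * N) - 1 / (2 * (b * N : ℕ)) := by
    push_cast
    rw [sub_nonneg]
    gcongr
    nlinarith
  refine (dist_pi_le_iff h0).2 fun i => ?_
  simp only [gridPoint]
  rw [dist_eq_norm, ← AddCircle.coe_sub]
  refine (QuotientAddGroup.norm_mk_le_norm).trans ?_
  have hu' : (u i : ℝ) + 1 ≤ b := by exact_mod_cast hu i
  have hu0 : (0 : ℝ) ≤ u i := by positivity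
  have e : (((b • v + u) i : ℕ) + 1 / 2 : ℝ) / (b * N : ℕ) - ((v i : ℝ) + 1 / 2) / N =
      ((u i : ℝ) + 1 / 2 - b / 2) / (b * N) := by
    simp only [Pi.add_apply, Pi.smul_apply, smul_eq_mul]
    push_cast
    field_simp
    ring
  have e2 : (1 : ℝ) / (2 * N) - 1 / (2 * (b * N : ℕ)) = ((b : ℝ) / 2 - 1 / 2) / (b * N) := by
    push_cast
    field_simp
  rw [e, e2, Real.norm_eq_abs, abs_div, abs_of_pos (show (0 : ℝ) < b * N by positivity)]
  gcongr
  rw [abs_le]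
  constructor <;> linarith

/-- One coordinate suffices: the index difference is congruent to `-2` modulo `b`, also after
wrapping around the torus, so it has absolute value at least 2 because `b ≥ 4`. The ancestors `v`,
`w` play no role, which lets the last digit alone separate two cells. -/
lemma le_dist_gridPoint_of_digit {d N b : ℕ} (hd : 1 ≤ d) (hN : 0 < N) (hb : 4 ≤ b)
    (v w : Fin d → ℕ) :
    2 / ((b * N : ℕ) : ℝ) ≤ dist (gridPoint (b * N) (b • v + fun _ => 0))
      (gridPoint (b * N) (b • w + fun _ => 2)) := by
  refine le_trans ?_ (dist_le_pi_dist _ _ ⟨0, hd⟩)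
  have := le_norm_intCast_div (m := 2) (N := b * N) (by positivity)
    (k := b * ((v ⟨0, hd⟩ : ℤ) - w ⟨0, hd⟩) - 2) (fun z => by
    have e : (b : ℤ) * ((v ⟨0, hd⟩ : ℤ) - w ⟨0, hd⟩) - 2 - (b * N : ℕ) * z =
      b * ((v ⟨0, hd⟩ : ℤ) - w ⟨0, hd⟩ - N * z) - 2 := by push_cast; ring
    rw [e]
    generalize (v ⟨0, hd⟩ : ℤ) - w ⟨0, hd⟩ - N * z = y
    have hb' : (4 : ℤ) ≤ b := by exact_mod_cast hb
    rw [le_abs]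
    rcases le_or_gt y 0 with h | h
    · right
      push_cast
      nlinarith
    · left
      push_cast
      nlinarith)
  rw [dist_eq_norm]
  refine (le_of_eq ?_).trans (this.trans (le_of_eq ?_))
  · norm_num
  · simp only [gridPoint, ← AddCircle.coe_sub]
    congr 2
    simp only [Pi.add_apply, Pi.smul_apply, smul_eq_mul]
    push_cast
    ring

/-- Volume packing: the open cells are disjoint and lie in the ball of radius `ρ + 1 / (2 * N)`. -/
lemma card_gridPoint_near_le {d N : ℕ} (hN : 2 ≤ N) (x : UnitAddTorus (Fin d)) {ρ : ℝ}
    (hρ : 0 < ρ) (S : Finset (Fin d → ℕ)) (hS : S ⊆ gridIndex d N)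
    (hx : ∀ v ∈ S, dist (gridPoint N v) x < ρ) :
    (S.card : ℝ) ≤ (2 * ρ * N + 1) ^ d := by
  have hN' : (2 : ℝ) ≤ N := by exact_mod_cast hN
  have h1 : volume (⋃ v ∈ S, Metric.ball (gridPoint N v) (1 / (2 * N))) =
      ∑ v ∈ S, volume (Metric.ball (gridPoint N v) (1 / (2 * N))) := by
    refine measure_biUnion_finset (fun v hv w hw hvw => ?_) fun v _ => measurableSet_ball
    refine Metric.ball_disjoint_ball ?_
    refine le_trans (le_of_eq ?_) (le_dist_gridPoint (hS hv) (hS hw) hvw)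
    field_simp
    norm_num
  have h2 : (⋃ v ∈ S, Metric.ball (gridPoint N v) (1 / (2 * N))) ⊆
      Metric.ball x (ρ + 1 / (2 * N)) := by
    refine Set.iUnion₂_subset fun v hv => Metric.ball_subset_ball' ?_
    linarith [hx v hv]
  have hpos : (0 : ℝ) < 1 / (2 * N) := by positivity
  have h3 := (measure_mono h2).trans (volume_ball_unitAddTorus_le x (by positivity))
  have h4 : (1 : ℝ) / (2 * N) ≤ 1 / 2 := by
    gcongr
    linarith
  simp_rw [h1, volume_ball_unitAddTorus _ hpos h4] at h3
  rw [Finset.sum_const, nsmul_eq_mul, ← ENNReal.ofReal_natCast,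
    ← ENNReal.ofReal_mul (by positivity), ENNReal.ofReal_le_ofReal_iff (by positivity)] at h3
  have e1 : (2 * (1 / (2 * (N : ℝ)))) = 1 / N := by field_simp
  have e2 : 2 * (ρ + 1 / (2 * (N : ℝ))) = (2 * ρ * N + 1) * (1 / N) := by field_simp
  rw [e1, e2, mul_pow] at h3
  exact le_of_mul_le_mul_right h3 (by positivity)

/-! ### Hitting events, independence, and the blocks of indices. -/

/-- The σ-algebra generated by the variables `ω n` with `n ∈ s`. -/
@[reducible]
def sigmaOf {Ω X : Type*} [MeasurableSpace X] (ω : ℕ+ → Ω → X) (s : Set ℕ+) : MeasurableSpace Ω :=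
  ⨆ n ∈ s, MeasurableSpace.comap (ω n) inferInstance

/-- The event that one of the points `ω n` with `n ∈ s` lies within distance `r` of `x`. -/
def hitEvent {Ω X : Type*} [MetricSpace X] (ω : ℕ+ → Ω → X) (s : Set ℕ+) (x : X) (r : ℝ) :
    Set Ω :=
  {a | ∃ n ∈ s, dist (ω n a) x < r}

/-- The indices `n` with `B ^ (i - 1) < n ≤ B ^ i`. -/
def block (B i : ℕ) : Finset ℕ+ :=
  {n ∈ Finset.Icc 1 ((B ^ i).toPNat') | (n : ℕ) ≤ B ^ i ∧ ∀ j < i, B ^ j < n}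

section General

variable {Ω X : Type*}

lemma sigmaOf_le [mΩ : MeasurableSpace Ω] [MeasurableSpace X] {ω : ℕ+ → Ω → X}
    (hmeas : ∀ n, Measurable (ω n)) (s : Set ℕ+) : sigmaOf ω s ≤ mΩ :=
  iSup₂_le fun n _ => (hmeas n).comap_le

lemma sigmaOf_mono [MeasurableSpace X] {ω : ℕ+ → Ω → X} {s t : Set ℕ+} (h : s ⊆ t) :
    sigmaOf ω s ≤ sigmaOf ω t :=
  biSup_mono h

lemma indep_sigmaOf [mΩ : MeasurableSpace Ω] [MeasurableSpace X] {P : Measure Ω}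
    {ω : ℕ+ → Ω → X} (hmeas : ∀ n, Measurable (ω n)) (hindep : iIndepFun ω P) {s t : Set ℕ+}
    (h : Disjoint s t) : Indep (sigmaOf ω s) (sigmaOf ω t) P :=
  indep_iSup_of_disjoint (fun n => (hmeas n).comap_le) hindep h

variable [MetricSpace X] {ω : ℕ+ → Ω → X}

lemma hitEvent_eq (s : Set ℕ+) (x : X) (r : ℝ) :
    hitEvent ω s x r = ⋃ n ∈ s, ω n ⁻¹' Metric.ball x r := by
  ext a
  simp [hitEvent]

variable [MeasurableSpace X] [OpensMeasurableSpace X]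

lemma measurableSet_hitEvent_sigmaOf (s : Set ℕ+) (x : X) (r : ℝ) :
    MeasurableSet[sigmaOf ω s] (hitEvent ω s x r) := by
  rw [hitEvent_eq]
  refine MeasurableSet.biUnion s.to_countable fun n hn => ?_
  exact (le_biSup (fun n => MeasurableSpace.comap (ω n) _) hn) _
    ⟨_, measurableSet_ball, rfl⟩

lemma measurableSet_hitEvent [MeasurableSpace Ω] (hmeas : ∀ n, Measurable (ω n)) (s : Set ℕ+)
    (x : X) (r : ℝ) : MeasurableSet (hitEvent ω s x r) :=
  sigmaOf_le hmeas s _ (measurableSet_hitEvent_sigmaOf s x r)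

end General

lemma measure_forall_notMem {Ω X : Type*} [MeasurableSpace Ω] [MeasurableSpace X] {P : Measure Ω}
    {μ : Measure X} [IsProbabilityMeasure μ] {ω : ℕ+ → Ω → X} (hmeas : ∀ n, Measurable (ω n))
    (hindep : iIndepFun ω P) (hunif : ∀ n, P.map (ω n) = μ) (s : Finset ℕ+) {V : Set X}
    (hV : MeasurableSet V) :
    P {a | ∀ n ∈ s, ω n a ∉ V} = (1 - μ V) ^ s.card := by
  have e : {a | ∀ n ∈ s, ω n a ∉ V} = ⋂ n ∈ s, ω n ⁻¹' Vᶜ := by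
    ext a
    simp
  rw [e, hindep.measure_inter_preimage_eq_mul s fun n _ => hV.compl]
  rw [Finset.prod_congr rfl fun n _ => ?_, Finset.prod_const]
  rw [← Measure.map_apply (hmeas n) hV.compl, hunif, prob_compl_eq_one_sub hV]

section Block

variable {B : ℕ}

/-- Quantifying over all `j < i` avoids the truncated exponent `i - 1` at `i = 0`, where the block
is `{1}`. -/
lemma mem_block (hB : 0 < B) {i : ℕ} {n : ℕ+} :
    n ∈ block B i ↔ (n : ℕ) ≤ B ^ i ∧ ∀ j < i, B ^ j < n := by
  simp only [block, Finset.mem_filter, Finset.mem_Icc, and_iff_right_iff_imp, one_le, true_and]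
  rintro ⟨h, -⟩
  rw [← PNat.coe_le_coe]
  simpa [PNat.coe_toPNat', pow_pos hB] using h

lemma map_block (hB : 0 < B) (i : ℕ) :
    (block B i).map ⟨PNat.val, PNat.coe_injective⟩ =
      {n ∈ Finset.Icc 1 (B ^ i) | ∀ j < i, B ^ j < n} := by
  ext n
  simp only [Finset.mem_map, mem_block hB, Function.Embedding.coeFn_mk, Finset.mem_filter,
    Finset.mem_Icc]
  constructor
  · rintro ⟨n, ⟨h1, h2⟩, rfl⟩
    exact ⟨⟨n.pos, h1⟩, h2⟩
  · rintro ⟨⟨h1, h2⟩, h3⟩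
    exact ⟨⟨n, h1⟩, ⟨h2, h3⟩, rfl⟩

lemma card_block_le (hB : 0 < B) (i : ℕ) : (block B i).card ≤ B ^ i := by
  rw [← Finset.card_map, map_block hB]
  exact (Finset.card_filter_le _ _).trans (by simp)

lemma card_block_succ (hB : 0 < B) (i : ℕ) : (block B (i + 1)).card = B ^ (i + 1) - B ^ i := by
  rw [← Finset.card_map, map_block hB]
  have : {n ∈ Finset.Icc 1 (B ^ (i + 1)) | ∀ j < i + 1, B ^ j < n} =
      Finset.Ioc (B ^ i) (B ^ (i + 1)) := by
    ext n
    simp only [Finset.mem_filter, Finset.mem_Icc, Finset.mem_Ioc]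
    constructor
    · rintro ⟨⟨_, h⟩, h2⟩
      exact ⟨h2 i (Nat.lt_succ_self i), h⟩
    · rintro ⟨h1, h2⟩
      exact ⟨⟨Nat.one_le_of_lt h1, h2⟩, fun j hj =>
        (Nat.pow_le_pow_right hB (Nat.lt_succ_iff.1 hj)).trans_lt h1⟩
  rw [this, Nat.card_Ioc]

lemma exists_mem_block (hB : 0 < B) {n : ℕ+} {k : ℕ} (hn : (n : ℕ) ≤ B ^ k) :
    ∃ i ≤ k, n ∈ block B i := by
  classical
  have h : ∃ i, (n : ℕ) ≤ B ^ i := ⟨k, hn⟩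
  refine ⟨Nat.find h, Nat.find_min' h hn, (mem_block hB).2 ⟨Nat.find_spec h, fun j hj => ?_⟩⟩
  exact not_le.1 (Nat.find_min h hj)

end Block

/-! ### Small `c`: exponential decay of the survival probability. -/

lemma measure_hitEvent_le {Ω : Type*} [MeasurableSpace Ω] {P : Measure Ω} {d : ℕ}
    {ω : ℕ+ → Ω → UnitAddTorus (Fin d)} (hmeas : ∀ n, Measurable (ω n))
    (hunif : ∀ n, P.map (ω n) = volume) (s : Finset ℕ+) (x : UnitAddTorus (Fin d)) {r : ℝ}
    (hr : 0 < r) : P (hitEvent ω s x r) ≤ ENNReal.ofReal (s.card * (2 * r) ^ d) := by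
  rw [hitEvent_eq]
  refine (measure_biUnion_finset_le s _).trans ?_
  rw [ENNReal.ofReal_mul (by positivity), ENNReal.ofReal_natCast, ← nsmul_eq_mul]
  refine Finset.sum_le_card_nsmul _ _ _ fun n _ => ?_
  rw [← Measure.map_apply (hmeas n) measurableSet_ball, hunif]
  exact volume_ball_unitAddTorus_le x hr

/-- The event that `x` lies within distance `c / b ^ j` of one of the first `b ^ (d * j)` points,
for every `j` with `m ≤ j < k`. -/
def surviveEvent {Ω X : Type*} [MetricSpace X] (ω : ℕ+ → Ω → X) (d b : ℕ) (c : ℝ) (m k : ℕ)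
    (x : X) : Set Ω :=
  ⋂ j ∈ Finset.Ico m k, hitEvent ω {n | (n : ℕ) ≤ (b ^ d) ^ j} x (c / b ^ j)

section Survive

variable {Ω : Type*} {d : ℕ} {ω : ℕ+ → Ω → UnitAddTorus (Fin d)}

lemma measurableSet_surviveEvent_sigmaOf (b : ℕ) (c : ℝ) (m k : ℕ) (x : UnitAddTorus (Fin d)) :
    MeasurableSet[sigmaOf ω {n | ∃ j < k, (n : ℕ) ≤ (b ^ d) ^ j}] (surviveEvent ω d b c m k x) := by
  refine Finset.measurableSet_biInter _ fun j hj => ?_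
  refine sigmaOf_mono ?_ _ (measurableSet_hitEvent_sigmaOf _ _ _)
  exact fun n hn => ⟨j, (Finset.mem_Ico.1 hj).2, hn⟩

/-- Decompose by the block `i` of the point that covers `x` at time `k`. The conditions at times
from `i` on are dropped, which makes the two factors independent. -/
lemma surviveEvent_succ_subset {b : ℕ} (hb : 0 < b) (c : ℝ) {m k : ℕ} (hmk : m ≤ k)
    (x : UnitAddTorus (Fin d)) :
    surviveEvent ω d b c m (k + 1) x ⊆ ⋃ i ∈ Finset.range (k + 1),
      surviveEvent ω d b c m i x ∩ hitEvent ω (block (b ^ d) i) x (c / b ^ k) := by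
  intro a ha
  simp only [surviveEvent, Set.mem_iInter] at ha
  obtain ⟨n, hn, hx⟩ := ha k (Finset.mem_Ico.2 ⟨hmk, Nat.lt_succ_self k⟩)
  obtain ⟨i, hik, hi⟩ := exists_mem_block (pow_pos hb d) hn
  simp only [Set.mem_iUnion, surviveEvent]
  refine ⟨i, Finset.mem_range.2 (Nat.lt_succ_of_le hik), Set.mem_iInter₂.2 fun j hj => ?_,
    n, hi, hx⟩
  rw [Finset.mem_Ico] at hj
  exact ha j (Finset.mem_Ico.2 ⟨hj.1, by omega⟩)

/-- The recursion for survival probabilities reproduces the rate `κ + 1 / B`: passing from `k` to `k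
+ 1` divides the old sum by `B` and adds one term with factor `κ`. -/
lemma sum_geometric_le {B κ : ℝ} (hB : 1 ≤ B) (hκ : 0 ≤ κ) (k : ℕ) :
    ∑ i ∈ Finset.range (k + 1), (κ + 1 / B) ^ i * (κ * B ^ i / B ^ k) ≤ (κ + 1 / B) ^ (k + 1) := by
  have hB0 : 0 < B := by linarith
  induction k with
  | zero => simp; positivity
  | succ k ih =>
    rw [Finset.sum_range_succ]
    have e : ∑ i ∈ Finset.range (k + 1), (κ + 1 / B) ^ i * (κ * B ^ i / B ^ (k + 1)) =
        (∑ i ∈ Finset.range (k + 1), (κ + 1 / B) ^ i * (κ * B ^ i / B ^ k)) * (1 / B) := by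
      rw [Finset.sum_mul]
      refine Finset.sum_congr rfl fun i _ => ?_
      rw [pow_succ]
      field_simp
    rw [e, mul_div_cancel_right₀ _ (by positivity), pow_succ _ (k + 1), mul_add, add_comm]
    gcongr

lemma measure_surviveEvent_le [MeasurableSpace Ω] {P : Measure Ω} [IsProbabilityMeasure P]
    (hmeas : ∀ n, Measurable (ω n)) (hindep : iIndepFun ω P)
    (hunif : ∀ n, P.map (ω n) = volume) {b : ℕ} (hb : 0 < b) {c : ℝ} (hc : 0 < c) {θ : ℝ}
    (hθ : θ = (2 * c) ^ d + 1 / (b : ℝ) ^ d) (hθ1 : θ ≤ 1) (m k : ℕ) (x : UnitAddTorus (Fin d)) :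
    P.real (surviveEvent ω d b c m k x) ≤ θ ^ k / θ ^ m := by
  have hb' : (1 : ℝ) ≤ b := by exact_mod_cast hb
  have hθ0 : 0 < θ := by rw [hθ]; positivity
  -- For `k ≤ m` the right side is at least 1, so the sum below may start at `i = 0` rather than at
  -- `m`.
  have triv : ∀ k ≤ m, P.real (surviveEvent ω d b c m k x) ≤ θ ^ k / θ ^ m := fun k hk => by
    refine measureReal_le_one.trans ?_
    rw [one_le_div (by positivity)]
    exact pow_le_pow_of_le_one hθ0.le hθ1 hk
  induction k using Nat.strong_induction_on with
  | _ k ih =>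
    rcases le_or_gt k m with hk | hk
    · exact triv k hk
    obtain ⟨k, rfl⟩ : ∃ l, k = l + 1 := ⟨k - 1, by omega⟩
    calc P.real (surviveEvent ω d b c m (k + 1) x)
        ≤ P.real (⋃ i ∈ Finset.range (k + 1), surviveEvent ω d b c m i x ∩
            hitEvent ω (block (b ^ d) i) x (c / b ^ k)) :=
          measureReal_mono (surviveEvent_succ_subset hb c (by omega) x) (measure_ne_top _ _)
      _ ≤ ∑ i ∈ Finset.range (k + 1), P.real (surviveEvent ω d b c m i x ∩
            hitEvent ω (block (b ^ d) i) x (c / b ^ k)) := measureReal_biUnion_finset_le _ _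
      _ ≤ ∑ i ∈ Finset.range (k + 1), (θ ^ i / θ ^ m) *
            ((2 * c) ^ d * ((b : ℝ) ^ d) ^ i / ((b : ℝ) ^ d) ^ k) := by
          refine Finset.sum_le_sum fun i hi => ?_
          have hind : P.real (surviveEvent ω d b c m i x ∩
            hitEvent ω (block (b ^ d) i) x (c / b ^ k)) = P.real (surviveEvent ω d b c m i x) *
              P.real (hitEvent ω (block (b ^ d) i) x (c / b ^ k)) := by
            -- Survival up to `i` tests only times `j < i`, hence only points before block `i`.
            have hdis : Disjoint {n : ℕ+ | ∃ j < i, (n : ℕ) ≤ (b ^ d) ^ j}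
                (block (b ^ d) i : Set ℕ+) := by
              refine Set.disjoint_left.2 fun n hn hn' => ?_
              obtain ⟨j, hj, hn⟩ := hn
              exact ((((mem_block (pow_pos hb d)).1 hn').2 j hj).trans_le hn).false
            have := (Indep_iff _ _ _).1 (indep_sigmaOf hmeas hindep hdis) _ _
              (measurableSet_surviveEvent_sigmaOf b c m i x)
              (measurableSet_hitEvent_sigmaOf _ x (c / b ^ k))
            rw [Measure.real, this, ENNReal.toReal_mul]
            rfl
          rw [hind]
          refine mul_le_mul (ih i (Finset.mem_range.1 hi)) ?_ measureReal_nonneg (by positivity)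
          refine (ENNReal.toReal_le_of_le_ofReal (by positivity) (measure_hitEvent_le hmeas hunif
            (block (b ^ d) i) x (r := c / b ^ k) (by positivity))).trans ?_
          have h1 : ((block (b ^ d) i).card : ℝ) ≤ ((b : ℝ) ^ d) ^ i := by
            exact_mod_cast card_block_le (pow_pos hb d) i
          have e : (2 * (c / (b : ℝ) ^ k)) ^ d = (2 * c) ^ d / ((b : ℝ) ^ d) ^ k := by
            rw [← mul_div_assoc, div_pow, ← pow_mul, ← pow_mul, mul_comm k]
          rw [e, mul_comm ((2 * c) ^ d), mul_div_assoc]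
          gcongr
      _ = (∑ i ∈ Finset.range (k + 1), θ ^ i *
            ((2 * c) ^ d * ((b : ℝ) ^ d) ^ i / ((b : ℝ) ^ d) ^ k)) / θ ^ m := by
          rw [Finset.sum_div]
          refine Finset.sum_congr rfl fun i _ => by ring
      _ ≤ θ ^ (k + 1) / θ ^ m := by
          gcongr
          rw [hθ]
          exact sum_geometric_le (one_le_pow₀ hb') (by positivity) k

end Survive

/-! ### Small `c`: from survival probabilities to Hausdorff dimension. -/

lemma ediam_closedBall_half_le {X : Type*} [PseudoMetricSpace X] (x : X) (N : ℕ) :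
    Metric.ediam (Metric.closedBall x (1 / (2 * N))) ≤ ENNReal.ofReal (1 / N) := by
  refine Metric.ediam_le fun y hy z hz => ?_
  rw [edist_dist]
  refine ENNReal.ofReal_le_ofReal ((dist_triangle_right y z x).trans ?_)
  have e : (1 : ℝ) / N = 1 / (2 * N) + 1 / (2 * N) := by ring
  rw [e]
  exact add_le_add hy hz

lemma div_rpow_natCast_pow {d b : ℕ} (hd : 1 ≤ d) (c : ℝ) (k : ℕ) :
    c / (((b ^ d) ^ k : ℕ) : ℝ) ^ (1 / (d : ℝ)) = c / (b : ℝ) ^ k := by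
  have hd' : d ≠ 0 := by omega
  congr 1
  push_cast
  rw [← pow_mul, mul_comm, pow_mul, one_div, Real.pow_rpow_inv_natCast (by positivity) hd']

open scoped Topology in
-- The cells surviving to `k` cover the set. The expected sum of the `s`-th powers of their
-- diameters is at most a constant times `(b ^ (d - s) * θ) ^ k`, which tends to 0; Fatou turns this
-- into zero Hausdorff measure almost surely.
lemma ae_dimH_le_of_surviveEvent {Ω : Type*} [MeasurableSpace Ω] {P : Measure Ω}
    [IsProbabilityMeasure P] {d : ℕ} {ω : ℕ+ → Ω → UnitAddTorus (Fin d)}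
    (hmeas : ∀ n, Measurable (ω n)) {b q : ℕ} (hb : 2 ≤ b) (hq : 0 < q) {c θ : ℝ} {s : NNReal}
    (hs : 0 < s) (hθ : 0 < θ) (hsd : (b : ℝ) ^ (d - s : ℝ) * θ < 1) {m : ℕ}
    (hP : ∀ k x, P.real (surviveEvent ω d b c m k x) ≤ θ ^ k / θ ^ m) :
    ∀ᵐ a ∂P, dimH {y | ∀ k, ∃ v ∈ gridIndex d (q * b ^ k),
      dist y (gridPoint (q * b ^ k) v) ≤ 1 / (2 * (q * b ^ k : ℕ)) ∧
        a ∈ surviveEvent ω d b c m k (gridPoint (q * b ^ k) v)} ≤ s := by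
  have hb0 : (0 : ℝ) < b := by positivity
  let f : ℕ → Ω → ENNReal := fun k a => ∑ v : gridIndex d (q * b ^ k),
    (surviveEvent ω d b c m k (gridPoint (q * b ^ k) v)).indicator
      (fun _ => ENNReal.ofReal (1 / (q * b ^ k : ℕ)) ^ (s : ℝ)) a
  have hmS : ∀ k x, MeasurableSet (surviveEvent ω d b c m k x) := fun k x =>
    sigmaOf_le hmeas _ _ (measurableSet_surviveEvent_sigmaOf b c m k x)
  have hf : ∀ k, Measurable (f k) := fun k =>
    Finset.measurable_sum _ fun v _ => measurable_const.indicator (hmS k _)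
  have hint : ∀ k, ∫⁻ a, f k a ∂P ≤
      ENNReal.ofReal ((q : ℝ) ^ (d - s : ℝ) / θ ^ m * ((b : ℝ) ^ (d - s : ℝ) * θ) ^ k) := by
    intro k
    have hN : (0 : ℝ) < (q * b ^ k : ℕ) := by positivity
    rw [lintegral_finsetSum _ fun v _ => measurable_const.indicator (hmS k _)]
    simp_rw [lintegral_indicator_const (hmS k _)]
    calc _ ≤ ∑ v : gridIndex d (q * b ^ k), ENNReal.ofReal ((1 / (q * b ^ k : ℕ)) ^ (s : ℝ)) *
          ENNReal.ofReal (θ ^ k / θ ^ m) := by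
          refine Finset.sum_le_sum fun v _ => ?_
          rw [ENNReal.ofReal_rpow_of_pos (by positivity)]
          gcongr
          rw [← ofReal_measureReal]
          exact ENNReal.ofReal_le_ofReal (hP k _)
      _ = ENNReal.ofReal ((q * b ^ k : ℕ) ^ d * ((1 / (q * b ^ k : ℕ)) ^ (s : ℝ) *
          (θ ^ k / θ ^ m))) := by
          rw [Finset.sum_const, Finset.card_univ, Fintype.card_coe, card_gridIndex, nsmul_eq_mul,
            ← ENNReal.ofReal_mul (by positivity), ← ENNReal.ofReal_natCast,
            ← ENNReal.ofReal_mul (by positivity)]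
          push_cast
          rfl
      _ ≤ _ := by
          refine ENNReal.ofReal_le_ofReal (le_of_eq ?_)
          have e : ((q * b ^ k : ℕ) : ℝ) ^ d * (1 / (q * b ^ k : ℕ)) ^ (s : ℝ) =
              (q : ℝ) ^ (d - s : ℝ) * ((b : ℝ) ^ (d - s : ℝ)) ^ k := by
            rw [one_div, Real.inv_rpow hN.le, ← Real.rpow_natCast, ← div_eq_mul_inv,
              ← Real.rpow_sub hN, Nat.cast_mul, Nat.cast_pow,
              Real.mul_rpow (by positivity) (by positivity), ← Real.rpow_natCast,
              ← Real.rpow_natCast, ← Real.rpow_mul hb0.le, ← Real.rpow_mul hb0.le, mul_comm (k : ℝ)]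
          rw [← mul_assoc, e, mul_pow]
          ring
  have hlim : Tendsto (fun k => ∫⁻ a, f k a ∂P) atTop (𝓝 0) := by
    refine tendsto_of_tendsto_of_tendsto_of_le_of_le tendsto_const_nhds ?_ (fun _ => zero_le) hint
    rw [← ENNReal.ofReal_zero]
    refine ENNReal.tendsto_ofReal ?_
    simpa using (tendsto_pow_atTop_nhds_zero_of_lt_one (by positivity) hsd).const_mul _
  have h0 : ∫⁻ a, liminf (fun k => f k a) atTop ∂P = 0 := by
    refine le_antisymm ((lintegral_liminf_le hf).trans ?_) zero_le
    rw [hlim.liminf_eq]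
  rw [lintegral_eq_zero_iff (Measurable.liminf hf)] at h0
  filter_upwards [h0] with a ha
  refine dimH_le_of_hausdorffMeasure_ne_top (ne_top_of_le_ne_top ENNReal.zero_ne_top ?_)
  classical
  refine (Measure.hausdorffMeasure_le_liminf_sum (ι := fun k => gridIndex d (q * b ^ k)) (s : ℝ) _
    (l := atTop) (fun k => ENNReal.ofReal (1 / (q * b ^ k : ℕ))) ?_
    (fun k v => if a ∈ surviveEvent ω d b c m k (gridPoint (q * b ^ k) v) then
      Metric.closedBall (gridPoint (q * b ^ k) v) (1 / (2 * (q * b ^ k : ℕ))) else ∅) ?_ ?_).trans ?_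
  · rw [← ENNReal.ofReal_zero]
    refine ENNReal.tendsto_ofReal ?_
    have : Tendsto (fun k => (1 / (q : ℝ)) * (1 / (b : ℝ)) ^ k) atTop (𝓝 (1 / (q : ℝ) * 0)) := by
      refine (tendsto_pow_atTop_nhds_zero_of_lt_one (by positivity) ?_).const_mul _
      rw [div_lt_one hb0]
      exact_mod_cast hb
    rw [mul_zero] at this
    refine this.congr fun k => ?_
    push_cast
    rw [one_div_pow, one_div_mul_one_div]
  · refine Eventually.of_forall fun k v => ?_
    split_ifs
    · exact ediam_closedBall_half_le _ _
    · simp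
  · refine Eventually.of_forall fun k y hy => ?_
    obtain ⟨v, hv, hyv, hav⟩ := hy k
    refine Set.mem_iUnion.2 ⟨⟨v, hv⟩, ?_⟩
    rw [if_pos hav]
    exact hyv
  · refine le_trans (liminf_le_liminf (Eventually.of_forall fun k => ?_)) (le_of_eq ha)
    refine Finset.sum_le_sum fun v _ => ?_
    split_ifs with h
    · rw [Set.indicator_of_mem h]
      gcongr
      exact ediam_closedBall_half_le _ _
    · simp [hs]

theorem ae_dimH_uniformCoveringSet_lt {Ω : Type*} [MeasurableSpace Ω] {P : Measure Ω}
    [IsProbabilityMeasure P] {d : ℕ} (hd : 1 ≤ d) {ω : ℕ+ → Ω → UnitAddTorus (Fin d)}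
    (hmeas : ∀ n, Measurable (ω n)) (hindep : iIndepFun ω P)
    (hunif : ∀ n, P.map (ω n) = volume) {c : ℝ} (hc : 0 < c) (hc2 : c < 1 / 2) :
    ∀ᵐ a ∂P, dimH (uniformCoveringSet (fun n => ω n a)
      (fun n => c / (n : ℝ) ^ (1 / (d : ℝ)))) < (d : ENNReal) := by
  have hd0 : d ≠ 0 := by omega
  -- The grid is `q + 1` times finer than the radius scale, so that moving to a cell centre costs `1
  -- / (2 * (q + 1))` in the constant and `c'` stays below `1 / 2`.
  obtain ⟨q, hq⟩ := exists_nat_one_div_lt (show 0 < 2 * (1 / 2 - c) by linarith)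
  set c' : ℝ := c + 1 / (2 * (q + 1 : ℕ)) with hc'
  have hqpos : (0 : ℝ) < 1 / (2 * (q + 1 : ℕ)) := by positivity
  have hc'0 : 0 < c' := by positivity
  have hc'2 : c' < 1 / 2 := by
    have : (1 : ℝ) / (2 * (q + 1 : ℕ)) = (1 / (q + 1)) / 2 := by
      push_cast
      field_simp
    rw [hc', this]
    linarith
  have hκ : (2 * c') ^ d < 1 := pow_lt_one₀ (by positivity) (by linarith) hd0
  obtain ⟨b₀, hb₀⟩ := exists_nat_one_div_lt (sub_pos.2 hκ)
  set b := b₀ + 2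
  have hb : 2 ≤ b := by omega
  have hb1 : (1 : ℝ) < b := by exact_mod_cast hb
  set θ : ℝ := (2 * c') ^ d + 1 / (b : ℝ) ^ d with hθ
  have hθ0 : 0 < θ := by positivity
  have hθ1 : θ < 1 := by
    have h1 : (b : ℝ) ≤ (b : ℝ) ^ d := le_self_pow₀ hb1.le hd0
    have h2 : (1 : ℝ) / (b : ℝ) ^ d ≤ 1 / (b₀ + 1) := by
      refine one_div_le_one_div_of_le (by positivity) (le_trans ?_ h1)
      simp only [b]
      push_cast
      linarith
    rw [hθ]
    linarith
  obtain ⟨t, ht0, ht1, hbt⟩ : ∃ t : ℝ, 0 < t ∧ t < 1 ∧ (b : ℝ) ^ t * θ < 1 := by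
    have hcont : ContinuousAt (fun t : ℝ => (b : ℝ) ^ t * θ) 0 :=
      (Real.continuousAt_const_rpow (by positivity)).mul continuousAt_const
    have h1 : ∀ᶠ t in nhds (0 : ℝ), (b : ℝ) ^ t * θ < 1 :=
      hcont.eventually_lt continuousAt_const (by simpa using hθ1)
    have h2 : ∀ᶠ t in nhdsWithin (0 : ℝ) (Set.Ioi 0), t ∈ Set.Ioo (0 : ℝ) 1 :=
      Ioo_mem_nhdsGT one_pos
    obtain ⟨t, h3, h4⟩ := ((h1.filter_mono nhdsWithin_le_nhds).and h2).exists
    exact ⟨t, h4.1, h4.2, h3⟩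
  have hd1 : (1 : ℝ) ≤ d := by exact_mod_cast hd
  let s : NNReal := ⟨d - t, by linarith⟩
  have hs0 : 0 < s := by
    rw [← NNReal.coe_pos]
    change 0 < (d : ℝ) - t
    linarith
  have hsd : s < d := by
    rw [← NNReal.coe_lt_coe]
    change (d : ℝ) - t < ((d : NNReal) : ℝ)
    simpa using ht0
  have key := fun m : ℕ => ae_dimH_le_of_surviveEvent (P := P) hmeas hb (Nat.succ_pos q) (c := c')
    (m := m) hs0 hθ0 (by
      change (b : ℝ) ^ ((d : ℝ) - (d - t)) * θ < 1
      rwa [sub_sub_cancel]) fun k x =>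
    measure_surviveEvent_le hmeas hindep hunif (by omega) hc'0 hθ hθ1.le m k x
  filter_upwards [ae_all_iff.2 key] with a ha
  refine lt_of_le_of_lt (b := (s : ENNReal)) ?_ (by exact_mod_cast hsd)
  refine (dimH_mono ?_).trans ((dimH_iUnion _).trans_le (iSup_le ha))
  intro y hy
  -- The threshold `m` for `N` also serves as a threshold for the exponent, since `m ≤ (b ^ d) ^ j`
  -- for `j ≥ m`; countably many `m` exhaust the covering set.
  obtain ⟨m, hm⟩ := eventually_atTop.1 (show ∀ᶠ N : ℕ+ in atTop, _ from hy)
  refine Set.mem_iUnion.2 ⟨m, fun k => ?_⟩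
  obtain ⟨v, hv, hyv⟩ := exists_dist_gridPoint_le (N := (q + 1) * b ^ k) (by positivity) y
  refine ⟨v, hv, hyv, Set.mem_iInter₂.2 fun j hj => ?_⟩
  rw [Finset.mem_Ico] at hj
  have hBm : (m : ℕ) ≤ (b ^ d) ^ j := by
    have h2 : 2 ≤ b ^ d := hb.trans (Nat.le_self_pow hd0 b)
    exact hj.1.trans ((Nat.lt_two_pow_self).le.trans (Nat.pow_le_pow_left h2 j))
  obtain ⟨n, hn, hny⟩ := hm ⟨(b ^ d) ^ j, by positivity⟩ hBm
  refine ⟨n, hn, (dist_triangle _ y _).trans_lt ?_⟩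
  have e := div_rpow_natCast_pow (b := b) hd c j
  have h1 : dist (ω n a) y < c / (b : ℝ) ^ j := by
    rw [← e]
    exact hny
  have h2 : (1 : ℝ) / (2 * ((q + 1) * b ^ k : ℕ)) ≤ 1 / (2 * (q + 1 : ℕ)) / (b : ℝ) ^ j := by
    rw [div_div]
    push_cast
    rw [← mul_assoc]
    have := pow_le_pow_right₀ hb1.le hj.2.le
    gcongr
  rw [hc', add_div]
  linarith

/-! ### Second-moment bounds for the number of cells that are hit. -/

open scoped Classical in
-- Chebyshev: only positively correlated pairs contribute to the upper bound for the variance, at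
-- most 1 each, so it is at most `S.card * K`.
lemma measureReal_le_card_filter_mem_le {Ω ι : Type*} [MeasurableSpace Ω] {P : Measure Ω}
    [IsProbabilityMeasure P] {S : Finset ι} (hS : S.Nonempty) {E : ι → Set Ω}
    (hE : ∀ v, MeasurableSet (E v)) {p K ε : ℝ} (hε : 0 < ε) (hp : ∀ v ∈ S, P.real (E v) = p)
    (hK : ∀ v ∈ S, (({w ∈ S | p ^ 2 < P.real (E v ∩ E w)} : Finset ι).card : ℝ) ≤ K) :
    P.real {a | (p + ε) * S.card ≤ ({v ∈ S | a ∈ E v} : Finset ι).card} ≤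
      K / (ε ^ 2 * S.card) := by
  have hn : (0 : ℝ) < S.card := by exact_mod_cast hS.card_pos
  let X : ι → Ω → ℝ := fun v => (E v).indicator 1
  let Z : Ω → ℝ := fun a => ∑ v ∈ S, (X v a - p)
  have hX : ∀ v, Integrable (X v) P := fun v => (integrable_const 1).indicator (hE v)
  have hXX : ∀ v w a, (X v a - p) * (X w a - p) =
      (E v ∩ E w).indicator 1 a - p * X v a - p * X w a + p ^ 2 := fun v w a => by
    have : (E v ∩ E w).indicator (1 : Ω → ℝ) a = X v a * X w a := by
      rw [Set.inter_indicator_one]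
      rfl
    rw [this]
    ring
  have hI : ∀ v w, Integrable ((E v ∩ E w).indicator (1 : Ω → ℝ)) P := fun v w =>
    (integrable_const 1).indicator ((hE v).inter (hE w))
  have hint : ∀ v w, Integrable (fun a => (X v a - p) * (X w a - p)) P := fun v w => by
    simp_rw [hXX]
    exact (((hI v w).sub ((hX v).const_mul p)).sub ((hX w).const_mul p)).add (integrable_const _)
  have hval : ∀ v ∈ S, ∀ w ∈ S, ∫ a, (X v a - p) * (X w a - p) ∂P =
      P.real (E v ∩ E w) - p ^ 2 := fun v hv w hw => by
    simp_rw [hXX]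
    have h1 : Integrable (fun a => (E v ∩ E w).indicator 1 a - p * X v a) P :=
      (hI v w).sub ((hX v).const_mul p)
    have h2 : Integrable (fun a => (E v ∩ E w).indicator 1 a - p * X v a - p * X w a) P :=
      h1.sub ((hX w).const_mul p)
    rw [integral_add h2 (integrable_const _), integral_sub h1 ((hX w).const_mul p), integral_sub (hI v w) ((hX v).const_mul p), integral_const_mul,
      integral_const_mul, integral_indicator_one (hE v), integral_indicator_one (hE w),
      integral_indicator_one ((hE v).inter (hE w)), hp v hv, hp w hw, integral_const]
    simp
    ring
  have hZ : ∀ a, Z a ^ 2 = ∑ v ∈ S, ∑ w ∈ S, (X v a - p) * (X w a - p) := fun a => by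
    rw [sq, Finset.sum_mul_sum]
  have hZint : Integrable (fun a => Z a ^ 2) P := by
    simp_rw [hZ]
    exact integrable_finsetSum _ fun v _ => integrable_finsetSum _ fun w _ => hint v w
  have hvar : ∫ a, Z a ^ 2 ∂P ≤ S.card * K := by
    simp_rw [hZ]
    rw [integral_finsetSum _ fun v _ => integrable_finsetSum _ fun w _ => hint v w,
      ← nsmul_eq_mul]
    refine Finset.sum_le_card_nsmul _ _ _ fun v hv => ?_
    rw [integral_finsetSum _ fun w _ => hint v w]
    refine le_trans ?_ (hK v hv)
    rw [Finset.card_filter, Nat.cast_sum]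
    refine Finset.sum_le_sum fun w hw => ?_
    rw [hval v hv w hw]
    split_ifs with h
    · have : P.real (E v ∩ E w) ≤ 1 := measureReal_le_one
      push_cast
      nlinarith [sq_nonneg p]
    · push_cast
      linarith
  have hsub : {a | (p + ε) * S.card ≤ ({v ∈ S | a ∈ E v} : Finset ι).card} ⊆
      {a | (ε * S.card) ^ 2 ≤ Z a ^ 2} := fun a ha => by
    have e : Z a = ({v ∈ S | a ∈ E v} : Finset ι).card - p * S.card := by
      simp only [Z, X, Finset.sum_sub_distrib, Finset.sum_const, nsmul_eq_mul]
      rw [Finset.card_filter, mul_comm p]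
      push_cast
      congr 1
    simp only [Set.mem_ofPred_eq] at ha ⊢
    have : ε * S.card ≤ Z a := by
      rw [e]
      linarith
    gcongr
  have hmarkov := mul_meas_ge_le_integral_of_nonneg (μ := P)
    (Eventually.of_forall fun a => sq_nonneg (Z a)) hZint ((ε * S.card) ^ 2)
  have h1 := measureReal_mono (μ := P) hsub (measure_ne_top _ _)
  refine h1.trans ?_
  rw [le_div_iff₀ (by positivity)]
  have h2 := hmarkov.trans hvar
  have h3 : S.card * (P.real {a | (ε * S.card) ^ 2 ≤ Z a ^ 2} * (ε ^ 2 * S.card)) ≤ S.card * K := by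
    refine le_trans (le_of_eq ?_) h2
    rw [Measure.real]
    ring
  exact le_of_mul_le_mul_left h3 hn

section Hits

variable {Ω : Type*} {d : ℕ} {ω : ℕ+ → Ω → UnitAddTorus (Fin d)}

lemma compl_hitEvent_eq (s : Finset ℕ+) (x : UnitAddTorus (Fin d)) (r : ℝ) :
    (hitEvent ω s x r)ᶜ = {a | ∀ n ∈ s, ω n a ∉ Metric.ball x r} := by
  ext a
  simp [hitEvent]

variable [MeasurableSpace Ω] {P : Measure Ω}

lemma measureReal_compl_hitEvent (hmeas : ∀ n, Measurable (ω n)) (hindep : iIndepFun ω P)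
    (hunif : ∀ n, P.map (ω n) = volume) (s : Finset ℕ+) (x : UnitAddTorus (Fin d)) {r : ℝ}
    (hr : 0 < r) (hr2 : r ≤ 1 / 2) :
    P.real (hitEvent ω s x r)ᶜ = (1 - (2 * r) ^ d) ^ s.card := by
  have h1 : (2 * r) ^ d ≤ 1 := pow_le_one₀ (by positivity) (by linarith)
  rw [compl_hitEvent_eq, Measure.real, measure_forall_notMem hmeas hindep hunif s measurableSet_ball,
    volume_ball_unitAddTorus x hr hr2, ENNReal.toReal_pow, ← ENNReal.ofReal_one,
    ← ENNReal.ofReal_sub _ (by positivity), ENNReal.toReal_ofReal (by linarith)]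

/-- The two balls are disjoint, and `1 - 2 * u ≤ (1 - u) ^ 2` for their common volume `u`. -/
lemma measureReal_compl_hitEvent_inter_le
    (hmeas : ∀ n, Measurable (ω n)) (hindep : iIndepFun ω P)
    (hunif : ∀ n, P.map (ω n) = volume) (s : Finset ℕ+) {x y : UnitAddTorus (Fin d)} {r : ℝ}
    (hr : 0 < r) (hr2 : r ≤ 1 / 2) (hxy : 2 * r ≤ dist x y) :
    P.real ((hitEvent ω s x r)ᶜ ∩ (hitEvent ω s y r)ᶜ) ≤ ((1 - (2 * r) ^ d) ^ s.card) ^ 2 := by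
  have e : (hitEvent ω s x r)ᶜ ∩ (hitEvent ω s y r)ᶜ =
      {a | ∀ n ∈ s, ω n a ∉ Metric.ball x r ∪ Metric.ball y r} := by
    rw [compl_hitEvent_eq, compl_hitEvent_eq]
    ext a
    simp only [Set.mem_inter_iff, Set.mem_ofPred_eq, Set.mem_union, not_or]
    exact ⟨fun h n hn => ⟨h.1 n hn, h.2 n hn⟩, fun h => ⟨fun n hn => (h n hn).1,
      fun n hn => (h n hn).2⟩⟩
  have hu : volume (Metric.ball x r ∪ Metric.ball y r) = ENNReal.ofReal (2 * (2 * r) ^ d) := by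
    rw [measure_union (Metric.ball_disjoint_ball (by linarith)) measurableSet_ball,
      volume_ball_unitAddTorus x hr hr2, volume_ball_unitAddTorus y hr hr2,
      ← ENNReal.ofReal_add (by positivity) (by positivity), ← two_mul]
  have hu1 : 2 * (2 * r) ^ d ≤ 1 := by
    have h := prob_le_one (μ := (volume : Measure (UnitAddTorus (Fin d))))
      (s := Metric.ball x r ∪ Metric.ball y r)
    rwa [hu, ENNReal.ofReal_le_one] at h
  rw [e, Measure.real, measure_forall_notMem hmeas hindep hunif s
    (measurableSet_ball.union measurableSet_ball), hu, ENNReal.toReal_pow, ← ENNReal.ofReal_one,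
    ← ENNReal.ofReal_sub _ (by positivity), ENNReal.toReal_ofReal (by linarith), ← pow_mul,
    mul_comm _ 2, pow_mul]
  refine pow_le_pow_left₀ (by linarith) ?_ _
  nlinarith [sq_nonneg ((2 * r) ^ d)]

/-- Bernoulli for `(1 + x) ^ M` together with `(1 - x) * (1 + x) ≤ 1`; this gives a rational lower
bound for the hitting probability. -/
lemma one_sub_pow_le {x : ℝ} (hx : 0 ≤ x) (hx1 : x ≤ 1) (M : ℕ) :
    (1 - x) ^ M ≤ 1 - M * x / (1 + M * x) := by
  have h1 : 0 < 1 + M * x := by positivity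
  have h2 : 1 + M * x ≤ (1 + x) ^ M := one_add_mul_le_pow (by linarith) M
  have h3 : (1 - x) ^ M * (1 + x) ^ M ≤ 1 := by
    rw [← mul_pow]
    exact pow_le_one₀ (by nlinarith) (by nlinarith)
  have h4 : (1 - x) ^ M * (1 + M * x) ≤ 1 :=
    (mul_le_mul_of_nonneg_left h2 (pow_nonneg (by linarith) M)).trans h3
  have e : 1 - M * x / (1 + M * x) = 1 / (1 + M * x) := by
    field_simp
    ring
  rw [e, le_div_iff₀ h1]
  exact h4

open scoped Classical in
-- Chebyshev is applied to the missed cells; pairs of centres at distance at least `2 * r` are not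
-- positively correlated, so packing bounds the rest.
lemma measureReal_card_filter_hitEvent_lt_le [IsProbabilityMeasure P]
    (hmeas : ∀ n, Measurable (ω n))
    (hindep : iIndepFun ω P) (hunif : ∀ n, P.map (ω n) = volume) (s : Finset ℕ+) {N : ℕ}
    (hN : 2 ≤ N) {r : ℝ} (hr : 0 < r) (hr2 : r ≤ 1 / 2) {S : Finset (Fin d → ℕ)}
    (hS : S.Nonempty) (hSN : S ⊆ gridIndex d N) {ε τ : ℝ} (hε : 0 < ε)
    (hτ : τ + ε ≤ s.card * (2 * r) ^ d / (1 + s.card * (2 * r) ^ d)) :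
    P.real {a | (({v ∈ S | a ∈ hitEvent ω s (gridPoint N v) r} : Finset _).card : ℝ) <
      τ * S.card} ≤ (4 * r * N + 1) ^ d / (ε ^ 2 * S.card) := by
  have hx1 : (2 * r) ^ d ≤ 1 := pow_le_one₀ (by positivity) (by linarith)
  have hp := one_sub_pow_le (by positivity) hx1 s.card
  refine le_trans (measureReal_mono ?_ (measure_ne_top _ _))
    (measureReal_le_card_filter_mem_le hS (P := P)
      (E := fun v => (hitEvent ω s (gridPoint N v) r)ᶜ)
      (fun v => (measurableSet_hitEvent hmeas _ _ _).compl) (K := (4 * r * N + 1) ^ d) hε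
      (fun v _ => measureReal_compl_hitEvent hmeas hindep hunif s (gridPoint N v) hr hr2) ?_)
  · intro a ha
    simp only [Set.mem_ofPred_eq, Set.mem_compl_iff] at ha ⊢
    have h1 := Finset.card_filter_add_card_filter_not (s := S)
      (fun v => a ∈ hitEvent ω s (gridPoint N v) r)
    have h2 : (({v ∈ S | a ∈ hitEvent ω s (gridPoint N v) r} : Finset _).card : ℝ) +
      ({v ∈ S | a ∉ hitEvent ω s (gridPoint N v) r} : Finset _).card = S.card := by
      exact_mod_cast h1
    have h3 : (((1 - (2 * r) ^ d) ^ s.card) + ε) * S.card ≤ (1 - τ) * S.card := by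
      gcongr
      linarith
    linarith
  · intro v _
    refine le_trans ?_ (card_gridPoint_near_le hN (gridPoint N v) (ρ := 2 * r) (by positivity)
      {w ∈ S | dist (gridPoint N w) (gridPoint N v) < 2 * r}
      ((Finset.filter_subset _ _).trans hSN) fun w hw => (Finset.mem_filter.1 hw).2) |>.trans
      (le_of_eq (by ring))
    rw [Nat.cast_le]
    refine Finset.card_le_card fun w hw => ?_
    rw [Finset.mem_filter] at hw ⊢
    refine ⟨hw.1, ?_⟩
    by_contra h
    refine absurd hw.2 (not_lt.2 (measureReal_compl_hitEvent_inter_le hmeas hindep hunif s hr hr2 ?_))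
    rw [dist_comm]
    exact not_lt.1 h

end Hits

/-! ### The tree of retained cells and its limit points. -/

/-- The positions at which cells may be chosen inside a cell of the `i`-th generation: all of them,
except that in every `g`-th generation the position is prescribed by a letter of `σ`. -/
def digitClass (d b g : ℕ) (σ : ℕ → Fin 2) (i : ℕ) : Finset (Fin d → ℕ) :=
  if g ∣ i + 1 then {fun _ => 2 * (σ (i / g) : ℕ)} else gridIndex d b

/-- The cells inside the cells of `A` at the positions `U`. -/
def subcells {d : ℕ} (b : ℕ) (A U : Finset (Fin d → ℕ)) : Finset (Fin d → ℕ) :=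
  (A ×ˢ U).image fun p => b • p.1 + p.2

open scoped Classical in
/-- The cells of the `i`-th generation all of whose ancestors are retained, where `R j` is the set
of retained cells of level `j` and the starting generation has level `j₀`. -/
noncomputable def cellTree {d : ℕ} (b q g j₀ : ℕ) (R : ℕ → Set (Fin d → ℕ)) (σ : ℕ → Fin 2) :
    ℕ → Finset (Fin d → ℕ)
  | 0 => gridIndex d (q * b ^ (j₀ + 1))
  | i + 1 => {v ∈ subcells b (cellTree b q g j₀ R σ i) (digitClass d b g σ i) | v ∈ R (j₀ + (i + 1))}

section Cells

variable {d b q g j₀ : ℕ} {R : ℕ → Set (Fin d → ℕ)} {σ : ℕ → Fin 2}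

lemma digitClass_subset (hb : 4 ≤ b) (σ : ℕ → Fin 2) (i : ℕ) :
    digitClass d b g σ i ⊆ gridIndex d b := by
  unfold digitClass
  split_ifs
  · rw [Finset.singleton_subset_iff, mem_gridIndex]
    intro _
    have := (σ (i / g)).isLt
    omega
  · exact subset_rfl

lemma card_digitClass (σ : ℕ → Fin 2) (i : ℕ) :
    (digitClass d b g σ i).card = if g ∣ i + 1 then 1 else b ^ d := by
  unfold digitClass
  split_ifs
  · simp
  · exact card_gridIndex d b

lemma card_subcells {A U : Finset (Fin d → ℕ)} (hU : U ⊆ gridIndex d b) :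
    (subcells b A U).card = A.card * U.card := by
  rw [subcells, Finset.card_image_of_injOn, Finset.card_product]
  rintro ⟨v, u⟩ h ⟨v', u'⟩ h' e
  simp only [Finset.coe_product, Set.mem_prod, Finset.mem_coe] at h h'
  have h1 := mem_gridIndex.1 (hU h.2)
  have h2 := mem_gridIndex.1 (hU h'.2)
  have key : ∀ i, v i = v' i ∧ u i = u' i := fun i => by
    have e1 : b * v i + u i = b * v' i + u' i := congrFun e i
    have hb : 0 < b := (Nat.zero_le _).trans_lt (h1 i)
    have e2 : (b * v i + u i) / b = v i := by
      rw [Nat.mul_add_div hb, Nat.div_eq_of_lt (h1 i), add_zero]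
    have e3 : (b * v' i + u' i) / b = v' i := by
      rw [Nat.mul_add_div hb, Nat.div_eq_of_lt (h2 i), add_zero]
    have e4 : v i = v' i := by rw [← e2, ← e3, e1]
    rw [e4] at e1
    exact ⟨e4, by omega⟩
  exact Prod.ext (funext fun i => (key i).1) (funext fun i => (key i).2)

lemma subcells_subset {N : ℕ} {A U : Finset (Fin d → ℕ)} (hA : A ⊆ gridIndex d N)
    (hU : U ⊆ gridIndex d b) : subcells b A U ⊆ gridIndex d (b * N) := by
  intro w hw
  simp only [subcells, Finset.mem_image, Finset.mem_product, Prod.exists] at hw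
  obtain ⟨v, u, ⟨hv, hu⟩, rfl⟩ := hw
  have h1 := mem_gridIndex.1 (hA hv)
  have h2 := mem_gridIndex.1 (hU hu)
  refine mem_gridIndex.2 fun i => ?_
  change b * v i + u i < b * N
  calc b * v i + u i < b * v i + b := by linarith [h2 i]
    _ = b * (v i + 1) := by ring
    _ ≤ b * N := Nat.mul_le_mul_left b (h1 i)

lemma mul_mul_pow_succ (b q k : ℕ) : q * b ^ (k + 1) = b * (q * b ^ k) := by ring

lemma mem_cellTree_succ {i : ℕ} {w : Fin d → ℕ} :
    w ∈ cellTree b q g j₀ R σ (i + 1) ↔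
      w ∈ subcells b (cellTree b q g j₀ R σ i) (digitClass d b g σ i) ∧ w ∈ R (j₀ + (i + 1)) := by
  classical
  rw [cellTree, Finset.mem_filter]

lemma cellTree_subset (hb : 4 ≤ b) (i : ℕ) :
    cellTree b q g j₀ R σ i ⊆ gridIndex d (q * b ^ (j₀ + i + 1)) := by
  induction i with
  | zero => exact subset_rfl
  | succ i ih =>
    rw [mul_mul_pow_succ]
    exact fun w hw => subcells_subset ih (digitClass_subset hb σ i) (mem_cellTree_succ.1 hw).1

/-- Up to generation `i` only `i / g` letters have been read. This reduces the uncountably many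
words to finitely many at each generation. -/
lemma cellTree_congr {σ' : ℕ → Fin 2} {i : ℕ} (h : ∀ k < i / g, σ k = σ' k) :
    cellTree b q g j₀ R σ i = cellTree b q g j₀ R σ' i := by
  induction i with
  | zero => rfl
  | succ i ih =>
    have e : digitClass d b g σ i = digitClass d b g σ' i := by
      unfold digitClass
      split_ifs with hi
      · rw [h (i / g)]
        rw [Nat.succ_div, if_pos hi]
        exact Nat.lt_succ_self _
      · rfl
    rw [cellTree, cellTree, e, ih fun k hk => h k (hk.trans_le (Nat.div_le_div_right (by omega)))]

lemma exists_limit_point (hb : 4 ≤ b) (hq : 0 < q)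
    (hne : ∀ i, (cellTree b q g j₀ R σ i).Nonempty) :
    ∃ y : UnitAddTorus (Fin d), ∀ i, ∃ v ∈ cellTree b q g j₀ R σ i,
      dist y (gridPoint (q * b ^ (j₀ + i + 1)) v) ≤ 1 / (2 * (q * b ^ (j₀ + i + 1) : ℕ)) := by
  let K : ℕ → Set (UnitAddTorus (Fin d)) := fun i => ⋃ v ∈ cellTree b q g j₀ R σ i,
    Metric.closedBall (gridPoint (q * b ^ (j₀ + i + 1)) v) (1 / (2 * (q * b ^ (j₀ + i + 1) : ℕ)))
  have hcl : ∀ i, IsClosed (K i) := fun i =>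
    Set.Finite.isClosed_biUnion (Finset.finite_toSet _) fun v _ => Metric.isClosed_closedBall
  have hanti : ∀ i, K (i + 1) ⊆ K i := fun i => by
    refine Set.iUnion₂_subset fun w hw => ?_
    rw [mem_cellTree_succ] at hw
    have hw' := hw.1
    simp only [subcells, Finset.mem_image, Finset.mem_product, Prod.exists] at hw'
    obtain ⟨v, u, ⟨hv, hu⟩, rfl⟩ := hw'
    refine Set.Subset.trans ?_ (Set.subset_biUnion_of_mem hv)
    refine Metric.closedBall_subset_closedBall' ?_
    have h1 := dist_gridPoint_child_le (N := q * b ^ (j₀ + i + 1)) (by positivity) v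
      (by omega : 0 < b) (mem_gridIndex.1 (digitClass_subset hb σ i hu))
    rw [← mul_mul_pow_succ] at h1
    have e : j₀ + (i + 1) + 1 = j₀ + i + 1 + 1 := by ring
    rw [e]
    linarith
  have hK : ∀ i, (K i).Nonempty := fun i => by
    obtain ⟨v, hv⟩ := hne i
    exact ⟨gridPoint _ v, Set.mem_biUnion hv (Metric.mem_closedBall_self (by positivity))⟩
  obtain ⟨y, hy⟩ := IsCompact.nonempty_iInter_of_sequence_nonempty_isCompact_isClosed K hanti hK
    (hcl 0).isCompact hcl
  refine ⟨y, fun i => ?_⟩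
  have := Set.mem_iInter.1 hy i
  simp only [K, Set.mem_iUnion, Metric.mem_closedBall] at this
  obtain ⟨v, hv, h⟩ := this
  exact ⟨v, hv, h⟩

/-- In generation `g * (k + 1)` the prescribed digits are 0 and 2, so the cell centres are two cell
widths apart; each limit point is within half a width of its centre, which leaves one width. -/
lemma le_dist_of_letter_ne (hd : 1 ≤ d) (hb : 4 ≤ b) (hq : 0 < q) (hg : 0 < g)
    {σ σ' : ℕ → Fin 2} {y y' : UnitAddTorus (Fin d)}
    (hy : ∀ i, ∃ v ∈ cellTree b q g j₀ R σ i,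
      dist y (gridPoint (q * b ^ (j₀ + i + 1)) v) ≤ 1 / (2 * (q * b ^ (j₀ + i + 1) : ℕ)))
    (hy' : ∀ i, ∃ v ∈ cellTree b q g j₀ R σ' i,
      dist y' (gridPoint (q * b ^ (j₀ + i + 1)) v) ≤ 1 / (2 * (q * b ^ (j₀ + i + 1) : ℕ)))
    {k : ℕ} (hk : σ k ≠ σ' k) :
    1 / ((q : ℝ) * b ^ (j₀ + g + 1)) * ((1 / b : ℝ) ^ g) ^ k ≤ dist y y' := by
  wlog h : σ k = 0 ∧ σ' k = 1 generalizing σ σ' y y'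
  · rw [dist_comm]
    exact this hy' hy hk.symm (by omega)
  obtain ⟨i, hi⟩ : ∃ i, i + 1 = g * (k + 1) := ⟨g * (k + 1) - 1, Nat.sub_add_cancel (Nat.mul_pos hg k.succ_pos)⟩
  have hik : i / g = k := by
    have h1 := Nat.succ_div (a := i) (b := g)
    rw [if_pos ⟨k + 1, hi⟩, hi, Nat.mul_div_cancel_left _ hg] at h1
    omega
  have hN : q * b ^ (j₀ + (i + 1) + 1) = b * (q * b ^ (j₀ + (i + 1))) := mul_mul_pow_succ _ _ _
  have hform : ∀ (τ : ℕ → Fin 2), ∀ v ∈ cellTree b q g j₀ R τ (i + 1),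
      ∃ w, v = b • w + fun _ => 2 * (τ k : ℕ) := by
    intro τ v hv
    rw [mem_cellTree_succ] at hv
    have hv' := hv.1
    simp only [subcells, Finset.mem_image, Finset.mem_product, Prod.exists] at hv'
    obtain ⟨w, u, ⟨_, hu⟩, rfl⟩ := hv'
    rw [digitClass, if_pos ⟨k + 1, hi⟩, Finset.mem_singleton, hik] at hu
    exact ⟨w, by rw [hu]⟩
  obtain ⟨v, hv, hyv⟩ := hy (i + 1)
  obtain ⟨v', hv', hyv'⟩ := hy' (i + 1)
  obtain ⟨w, rfl⟩ := hform σ v hv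
  obtain ⟨w', rfl⟩ := hform σ' v' hv'
  rw [h.1] at hyv
  rw [h.2] at hyv'
  have hsep := le_dist_gridPoint_of_digit hd (N := q * b ^ (j₀ + (i + 1))) (by positivity) hb w w'
  rw [← hN] at hsep
  have h4 := dist_triangle4 (gridPoint (q * b ^ (j₀ + (i + 1) + 1)) (b • w + fun _ => 0)) y y'
    (gridPoint (q * b ^ (j₀ + (i + 1) + 1)) (b • w' + fun _ => 2))
  rw [dist_comm _ y] at h4
  have hyv1 : dist y (gridPoint (q * b ^ (j₀ + (i + 1) + 1)) (b • w + fun _ => 0)) ≤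
    1 / (2 * (q * b ^ (j₀ + (i + 1) + 1) : ℕ)) := hyv
  have hyv2 : dist y' (gridPoint (q * b ^ (j₀ + (i + 1) + 1)) (b • w' + fun _ => 2)) ≤
    1 / (2 * (q * b ^ (j₀ + (i + 1) + 1) : ℕ)) := hyv'
  have e1 : (2 : ℝ) / (q * b ^ (j₀ + (i + 1) + 1) : ℕ) =
      1 / (2 * (q * b ^ (j₀ + (i + 1) + 1) : ℕ)) + 1 / (2 * (q * b ^ (j₀ + (i + 1) + 1) : ℕ)) +
        1 / (q * b ^ (j₀ + (i + 1) + 1) : ℕ) := by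
    ring
  have e2 : 1 / ((q : ℝ) * b ^ (j₀ + g + 1)) * ((1 / b : ℝ) ^ g) ^ k =
      1 / (q * b ^ (j₀ + (i + 1) + 1) : ℕ) := by
    rw [hi, ← pow_mul, one_div_pow, one_div_mul_one_div]
    push_cast
    rw [mul_assoc, ← pow_add]
    congr 3
    ring
  rw [e2]
  linarith

end Cells

/-! ### Positive dimension of a separated family indexed by binary words. -/

lemma dimH_range_pos_of_separated {X : Type*} [MetricSpace X] (y : (ℕ → Fin 2) → X) {C η : ℝ}
    (hC : 0 < C) (hη : 0 < η) (hη1 : η < 1)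
    (hy : ∀ σ σ' k, σ k ≠ σ' k → C * η ^ k ≤ dist (y σ) (y σ')) : 0 < dimH (Set.range y) := by
  have hinj : Function.Injective y := fun σ σ' h => by
    by_contra hne
    obtain ⟨k, hk⟩ := Function.ne_iff.1 hne
    have := hy σ σ' k hk
    rw [h, dist_self] at this
    have : 0 < C * η ^ k := by positivity
    linarith
  let f : X → ℝ := fun x => Real.ofDigits (Function.invFun y x)
  have hf : ∀ σ, f (y σ) = Real.ofDigits σ := fun σ => by
    simp only [f, Function.leftInverse_invFun hinj σ]
  -- With `η ^ r = 1 / 2`, words first differing at `k` have binary values within `2⁻ᵏ = (η ^ k) ^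
  -- r`, so the map from points to binary values is `r`-Hölder.
  let r : ℝ := Real.logb η (1 / 2)
  have hr : 0 < r := by
    refine Real.logb_pos_of_base_lt_one hη hη1 (by norm_num) (by norm_num)
  have hηr : η ^ r = 1 / 2 := Real.rpow_logb hη hη1.ne (by norm_num)
  have hholder : HolderOnWith (Real.toNNReal ((1 / C) ^ r)) (Real.toNNReal r) f (Set.range y) := by
    rintro _ ⟨σ, rfl⟩ _ ⟨σ', rfl⟩
    rw [hf, hf, edist_dist, edist_dist, Real.coe_toNNReal _ hr.le,
      ENNReal.ofReal_rpow_of_nonneg dist_nonneg hr.le, ENNReal.ofNNReal_toNNReal,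
      ← ENNReal.ofReal_mul (by positivity), ← Real.mul_rpow (by positivity) dist_nonneg]
    refine ENNReal.ofReal_le_ofReal ?_
    rcases eq_or_ne σ σ' with rfl | hne
    · rw [dist_self]
      positivity
    classical
    have hex := Function.ne_iff.1 hne
    have hk := hy σ σ' _ (Nat.find_spec hex)
    have hlt : ∀ i < Nat.find hex, σ i = σ' i := fun i hi => not_not.1 (Nat.find_min hex hi)
    generalize Nat.find hex = k at hk hlt
    rw [Real.dist_eq]
    refine (Real.abs_ofDigits_sub_ofDigits_le hlt).trans ?_
    have e : (((2 : ℕ) : ℝ) ^ k)⁻¹ = (η ^ k) ^ r := by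
      rw [← Real.rpow_natCast η, ← Real.rpow_mul hη.le, mul_comm (k : ℝ), Real.rpow_mul hη.le, hηr,
        Real.rpow_natCast]
      simp
    rw [e]
    refine Real.rpow_le_rpow (by positivity) ?_ hr.le
    rw [one_div_mul_eq_div, le_div_iff₀ hC, mul_comm]
    exact hk
  have h1 := hholder.dimH_image_le (Real.toNNReal_pos.2 hr)
  have h2 : Set.Icc (0 : ℝ) 1 ⊆ f '' Set.range y := fun t ht => by
    obtain ⟨σ, -, rfl⟩ := Real.ofDigits_SurjOn (b := 2) one_lt_two ht
    exact ⟨y σ, ⟨σ, rfl⟩, hf σ⟩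
  have h3 : dimH (Set.Icc (0 : ℝ) 1) = 1 := by
    rw [Real.dimH_of_nonempty_interior (by simp [interior_Icc])]
    simp
  have h4 := (h3 ▸ dimH_mono h2).trans h1
  rw [pos_iff_ne_zero]
  intro h0
  rw [h0, ENNReal.zero_div] at h4
  exact absurd h4 (by simp)

/-! ### Large `c`: simultaneous survival of the random trees of all words. -/

/-- The cells of level `j` that are covered by a ball of radius `c / b ^ (j + 1)` around one of the
points in the `j`-th block. -/
def retainedCells {d : ℕ} (x : ℕ+ → UnitAddTorus (Fin d))
    (b q : ℕ) (c : ℝ) (j : ℕ) : Set (Fin d → ℕ) :=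
  {v | ∃ n ∈ block (b ^ d) j, dist (x n) (gridPoint (q * b ^ (j + 1)) v) < c / b ^ (j + 1)}

section RandomTree

variable {Ω : Type*} {d b q g : ℕ} {ω : ℕ+ → Ω → UnitAddTorus (Fin d)} {c : ℝ}

lemma measurableSet_mem_cellTree_sigmaOf (hb : 0 < b) (j₀ : ℕ) (σ : ℕ → Fin 2) (i : ℕ)
    (v : Fin d → ℕ) :
    MeasurableSet[sigmaOf ω {n | (n : ℕ) ≤ (b ^ d) ^ (j₀ + i)}]
      {a | v ∈ cellTree b q g j₀ (retainedCells (fun n => ω n a) b q c) σ i} := by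
  induction i generalizing v with
  | zero =>
    simp only [cellTree]
    exact @MeasurableSet.const _ (sigmaOf ω _) _
  | succ i ih =>
    have e : {a | v ∈ cellTree b q g j₀ (retainedCells (fun n => ω n a) b q c) σ (i + 1)} =
        (⋃ p ∈ {p : (Fin d → ℕ) × (Fin d → ℕ) | p.2 ∈ digitClass d b g σ i ∧ b • p.1 + p.2 = v},
          {a | p.1 ∈ cellTree b q g j₀ (retainedCells (fun n => ω n a) b q c) σ i}) ∩
        hitEvent ω (block (b ^ d) (j₀ + (i + 1))) (gridPoint (q * b ^ (j₀ + (i + 1) + 1)) v)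
          (c / b ^ (j₀ + (i + 1) + 1)) := by
      ext a
      simp only [Set.mem_ofPred_eq, Set.mem_inter_iff, Set.mem_iUnion, mem_cellTree_succ, subcells,
        Finset.mem_image, Finset.mem_product]
      refine and_congr ⟨?_, ?_⟩ Iff.rfl
      · rintro ⟨p, ⟨h1, h2⟩, h3⟩
        exact ⟨p, ⟨h2, h3⟩, h1⟩
      · rintro ⟨p, ⟨h2, h3⟩, h1⟩
        exact ⟨p, ⟨h1, h2⟩, h3⟩
    rw [e]
    have hB : 0 < b ^ d := pow_pos hb d
    refine MeasurableSet.inter (MeasurableSet.biUnion (Set.to_countable _) fun p _ =>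
      sigmaOf_mono ?_ _ (ih p.1)) (sigmaOf_mono ?_ _ (measurableSet_hitEvent_sigmaOf _ _ _))
    · exact fun n hn => le_trans hn (Nat.pow_le_pow_right hB (by omega))
    · exact fun n hn => ((mem_block hB).1 hn).1

lemma measurableSet_cellTree_eq_sigmaOf (hb : 0 < b) (j₀ : ℕ) (σ : ℕ → Fin 2) (i : ℕ)
    (C : Finset (Fin d → ℕ)) :
    MeasurableSet[sigmaOf ω {n | (n : ℕ) ≤ (b ^ d) ^ (j₀ + i)}]
      {a | cellTree b q g j₀ (retainedCells (fun n => ω n a) b q c) σ i = C} := by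
  have e : {a | cellTree b q g j₀ (retainedCells (fun n => ω n a) b q c) σ i = C} =
      ⋂ v, {a | v ∈ cellTree b q g j₀ (retainedCells (fun n => ω n a) b q c) σ i ↔ v ∈ C} := by
    ext a
    simp [Finset.ext_iff]
  rw [e]
  refine MeasurableSet.iInter fun v => ?_
  by_cases hv : v ∈ C
  · simp only [hv, iff_true]
    exact measurableSet_mem_cellTree_sigmaOf hb j₀ σ i v
  · simp only [hv, iff_false]
    exact (measurableSet_mem_cellTree_sigmaOf hb j₀ σ i v).compl

lemma card_block_mul_pow (hb : 0 < b) (hc : 0 < c) (j : ℕ) :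
    ((block (b ^ d) (j + 1)).card : ℝ) * (2 * (c / b ^ (j + 1 + 1))) ^ d =
      (2 * c) ^ d * (1 - 1 / (b : ℝ) ^ d) / (b : ℝ) ^ d := by
  have hB : 0 < b ^ d := pow_pos hb d
  have hb' : (0 : ℝ) < (b : ℝ) ^ d := by exact_mod_cast hB
  rw [card_block_succ hB, Nat.cast_sub (Nat.pow_le_pow_right hB (Nat.le_succ j)), ← mul_div_assoc,
    div_pow, ← pow_mul (b : ℝ), mul_comm (j + 1 + 1) d, pow_mul]
  push_cast
  generalize (b : ℝ) ^ d = B at hb'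
  field_simp
  rw [Nat.succ_eq_add_one]
  ring

variable [MeasurableSpace Ω] {P : Measure Ω} [IsProbabilityMeasure P]

/-- Condition on the value `C` of generation `i`, which depends only on points up to `(b ^ d) ^ (j₀
+ i)`. The next block is independent of it, and the second-moment bound applies to the subcells of
`C`. Radius times grid size is constant, so the packing constant does not depend on the level. -/
lemma measureReal_cellTree_drop_le (hmeas : ∀ n, Measurable (ω n)) (hindep : iIndepFun ω P)
    (hunif : ∀ n, P.map (ω n) = volume) (hb : 4 ≤ b) (hq : 0 < q) (hc : 0 < c) (hcb : 2 * c ≤ b)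
    {τ ε : ℝ} (hτ : 0 ≤ τ) (hε : 0 < ε)
    (hτε : τ + ε ≤ (2 * c) ^ d * (1 - 1 / (b : ℝ) ^ d) / (b : ℝ) ^ d /
      (1 + (2 * c) ^ d * (1 - 1 / (b : ℝ) ^ d) / (b : ℝ) ^ d))
    (j₀ : ℕ) (σ : ℕ → Fin 2) (i : ℕ) {L : ℝ} (hL : 0 < L) :
    P.real {a | L ≤ (cellTree b q g j₀ (retainedCells (fun n => ω n a) b q c) σ i).card ∧
      ((cellTree b q g j₀ (retainedCells (fun n => ω n a) b q c) σ (i + 1)).card : ℝ) <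
        τ * (digitClass d b g σ i).card * L} ≤ (4 * c * q + 1) ^ d / (ε ^ 2 * L) := by
  classical
  have hb0 : (0 : ℝ) < b := by positivity
  have hB : 0 < b ^ d := pow_pos (by omega) d
  set j := j₀ + i with hj
  set U := digitClass d b g σ i with hU
  have hU1 : 1 ≤ U.card := by
    rw [hU, card_digitClass]
    split_ifs
    · exact le_rfl
    · exact hB
  let T : Ω → Finset (Fin d → ℕ) := fun a =>
    cellTree b q g j₀ (retainedCells (fun n => ω n a) b q c) σ i
  let D : Finset (Finset (Fin d → ℕ)) :=
    {C ∈ (gridIndex d (q * b ^ (j + 1))).powerset | L ≤ C.card}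
  let H : Finset (Fin d → ℕ) → Set Ω := fun C => {a | (({v ∈ subcells b C U | a ∈ hitEvent ω
    (block (b ^ d) (j + 1)) (gridPoint (q * b ^ (j + 1 + 1)) v) (c / b ^ (j + 1 + 1))} :
      Finset _).card : ℝ) < τ * (subcells b C U).card}
  have hsub : {a | L ≤ (T a).card ∧
      ((cellTree b q g j₀ (retainedCells (fun n => ω n a) b q c) σ (i + 1)).card : ℝ) <
        τ * U.card * L} ⊆ ⋃ C ∈ D, {a | T a = C} ∩ H C := by
    rintro a ⟨h1, h2⟩
    refine Set.mem_biUnion (x := T a) (Finset.mem_coe.2 (Finset.mem_filter.2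
      ⟨Finset.mem_powerset.2 (cellTree_subset hb i), h1⟩)) ⟨rfl, ?_⟩
    change (_ : ℝ) < _
    have e : ({v ∈ subcells b (T a) U | a ∈ hitEvent ω (block (b ^ d) (j + 1))
        (gridPoint (q * b ^ (j + 1 + 1)) v) (c / b ^ (j + 1 + 1))} : Finset _) =
        cellTree b q g j₀ (retainedCells (fun n => ω n a) b q c) σ (i + 1) := by
      ext v
      rw [Finset.mem_filter, mem_cellTree_succ]
      rfl
    rw [e, card_subcells (digitClass_subset hb σ i)]
    refine h2.trans_le ?_
    push_cast
    rw [mul_assoc, mul_comm ((T a).card : ℝ)]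
    gcongr
  have hHmeas : ∀ C, MeasurableSet[sigmaOf ω (block (b ^ d) (j + 1))] (H C) := fun C => by
    have e : H C = ⋃ V ∈ (subcells b C U).powerset.filter
        (fun V => (V.card : ℝ) < τ * (subcells b C U).card), ⋂ v ∈ subcells b C U,
          {a | a ∈ hitEvent ω (block (b ^ d) (j + 1)) (gridPoint (q * b ^ (j + 1 + 1)) v)
            (c / b ^ (j + 1 + 1)) ↔ v ∈ V} := by
      ext a
      simp only [H, Set.mem_iUnion, Set.mem_iInter, Finset.mem_filter, Finset.mem_powerset,
        Set.mem_ofPred_eq]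
      constructor
      · intro h
        exact ⟨_, ⟨Finset.filter_subset _ _, h⟩, fun v hv => by simp [hv]⟩
      · rintro ⟨V, ⟨hV, h⟩, hv⟩
        convert h using 3
        ext v
        rw [Finset.mem_filter]
        exact ⟨fun h => (hv v h.1).1 h.2, fun h => ⟨hV h, (hv v (hV h)).2 h⟩⟩
    rw [e]
    refine Finset.measurableSet_biUnion _ fun V _ => Finset.measurableSet_biInter _ fun v _ => ?_
    by_cases hv : v ∈ V
    · simp only [hv, iff_true]
      exact measurableSet_hitEvent_sigmaOf _ _ _
    · simp only [hv, iff_false]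
      exact (measurableSet_hitEvent_sigmaOf _ _ _).compl
  have hdis : Disjoint {n : ℕ+ | (n : ℕ) ≤ (b ^ d) ^ j} (block (b ^ d) (j + 1) : Set ℕ+) :=
    Set.disjoint_left.2 fun n hn hn' =>
      (((mem_block hB).1 hn').2 j (Nat.lt_succ_self j)).not_ge hn
  have hterm : ∀ C ∈ D, P.real ({a | T a = C} ∩ H C) ≤
      P.real {a | T a = C} * ((4 * c * q + 1) ^ d / (ε ^ 2 * L)) := fun C hC => by
    rw [Finset.mem_filter, Finset.mem_powerset] at hC
    have hind := (Indep_iff _ _ _).1 (indep_sigmaOf hmeas hindep hdis) _ _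
      (measurableSet_cellTree_eq_sigmaOf (q := q) (g := g) (c := c) (by omega) j₀ σ i C) (hHmeas C)
    have e : P.real ({a | T a = C} ∩ H C) = P.real {a | T a = C} * P.real (H C) := by
      rw [Measure.real, hind, ENNReal.toReal_mul]
      rfl
    rw [e]
    refine mul_le_mul_of_nonneg_left ?_ measureReal_nonneg
    have hcard : L ≤ (subcells b C U).card := by
      rw [card_subcells (digitClass_subset hb σ i)]
      refine hC.2.trans ?_
      exact_mod_cast Nat.le_mul_of_pos_right _ hU1
    have hne : (subcells b C U).Nonempty := by
      rw [← Finset.card_pos]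
      exact_mod_cast hL.trans_le hcard
    have hbp : (b : ℝ) ≤ (b : ℝ) ^ (j + 1 + 1) :=
      le_self_pow₀ (by exact_mod_cast (by omega : 1 ≤ b)) (by omega)
    have hr2 : c / (b : ℝ) ^ (j + 1 + 1) ≤ 1 / 2 := by
      rw [div_le_iff₀ (by positivity)]
      linarith
    have hN : 2 ≤ q * b ^ (j + 1 + 1) := by
      have h1 : b ≤ b ^ (j + 1 + 1) := Nat.le_self_pow (by omega) b
      nlinarith
    have hSN : subcells b C U ⊆ gridIndex d (q * b ^ (j + 1 + 1)) := by
      rw [mul_mul_pow_succ]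
      exact subcells_subset hC.1 (digitClass_subset hb σ i)
    refine (measureReal_card_filter_hitEvent_lt_le hmeas hindep hunif (block (b ^ d) (j + 1)) hN
      (r := c / b ^ (j + 1 + 1)) (by positivity) hr2 hne hSN hε ?_).trans ?_
    · rw [card_block_mul_pow (by omega) hc]
      exact hτε
    · have e2 : 4 * (c / (b : ℝ) ^ (j + 1 + 1)) * (q * b ^ (j + 1 + 1) : ℕ) + 1 =
          4 * c * q + 1 := by
        push_cast
        field_simp
      rw [e2]
      gcongr
  calc _ ≤ P.real (⋃ C ∈ D, {a | T a = C} ∩ H C) := measureReal_mono hsub (measure_ne_top _ _)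
    _ ≤ ∑ C ∈ D, P.real ({a | T a = C} ∩ H C) := measureReal_biUnion_finset_le _ _
    _ ≤ ∑ C ∈ D, P.real {a | T a = C} * ((4 * c * q + 1) ^ d / (ε ^ 2 * L)) :=
        Finset.sum_le_sum hterm
    _ = P.real (⋃ C ∈ D, {a | T a = C}) * ((4 * c * q + 1) ^ d / (ε ^ 2 * L)) := by
        rw [← Finset.sum_mul, measureReal_biUnion_finset]
        · intro C _ C' _ hne
          refine Set.disjoint_left.2 fun a h h' => hne ?_
          rw [← show T a = C from h, ← show T a = C' from h']
        · exact fun C _ => sigmaOf_le hmeas _ _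
            (measurableSet_cellTree_eq_sigmaOf (by omega) j₀ σ i C)
    _ ≤ 1 * ((4 * c * q + 1) ^ d / (ε ^ 2 * L)) := by
        gcongr
        exact measureReal_le_one
    _ = _ := one_mul _

/-- Extension of a finite word by zeros. -/
def extendWord {k : ℕ} (f : Fin k → Fin 2) (n : ℕ) : Fin 2 := if h : n < k then f ⟨n, h⟩ else 0

lemma measure_exists_cellTree_eq_empty_le (hmeas : ∀ n, Measurable (ω n))
    (hindep : iIndepFun ω P) (hunif : ∀ n, P.map (ω n) = volume) (hb : 4 ≤ b) (hq : 0 < q)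
    (hc : 0 < c) (hcb : 2 * c ≤ b) {τ ε β : ℝ} (hε : 0 < ε)
    (hτε : τ + ε ≤ (2 * c) ^ d * (1 - 1 / (b : ℝ) ^ d) / (b : ℝ) ^ d /
      (1 + (2 * c) ^ d * (1 - 1 / (b : ℝ) ^ d) / (b : ℝ) ^ d))
    (hβ : 1 < β) (hβτ : β ^ 2 = b ^ d * τ) (hg : 2 * (b : ℝ) ^ d ≤ β ^ g) (j₀ : ℕ) :
    P {a | ∃ σ i, cellTree b q g j₀ (retainedCells (fun n => ω n a) b q c) σ i = ∅} ≤
      ENNReal.ofReal (2 * (4 * c * q + 1) ^ d / (ε ^ 2 * (q * b ^ (j₀ + 1) : ℕ) ^ d) *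
        (1 - 1 / β)⁻¹) := by
  have hb0 : (0 : ℝ) < b := by positivity
  have hBpos : (0 : ℝ) < (b : ℝ) ^ d := by positivity
  have hβ0 : 0 < β := by linarith
  have hτ0 : 0 < τ := by
    by_contra h
    nlinarith [mul_nonneg hBpos.le (neg_nonneg.2 (not_lt.1 h)), sq_pos_of_pos hβ0]
  -- The guaranteed population: a factor `b ^ d * τ = β ^ 2` per free generation, and only `τ` in
  -- the generations whose position is prescribed.
  let L : ℕ → ℝ := fun i => ((q * b ^ (j₀ + 1) : ℕ) : ℝ) ^ d * (β ^ 2) ^ i / ((b : ℝ) ^ d) ^ (i / g)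
  have hLpos : ∀ i, 0 < L i := fun i => by positivity
  have hLsucc : ∀ σ i, L (i + 1) = τ * (digitClass d b g σ i).card * L i := fun σ i => by
    simp only [L]
    rw [card_digitClass, Nat.succ_div, pow_succ (β ^ 2)]
    split_ifs
    · rw [pow_succ ((b : ℝ) ^ d), hβτ]
      field_simp
      simp
    · rw [add_zero, hβτ]
      push_cast
      ring
  let F : (i : ℕ) → (Fin ((i + 1) / g) → Fin 2) → Set Ω := fun i f =>
    {a | L i ≤ (cellTree b q g j₀ (retainedCells (fun n => ω n a) b q c) (extendWord f) i).card ∧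
      ((cellTree b q g j₀ (retainedCells (fun n => ω n a) b q c) (extendWord f) (i + 1)).card : ℝ) <
        τ * (digitClass d b g (extendWord f) i).card * L i}
  -- If no generation falls short, the population stays above `L > 0`. A shortfall at step `i` is
  -- seen by the first `(i + 1) / g` letters, so the bad event lies in a countable union.
  have hsub : {a | ∃ σ i, cellTree b q g j₀ (retainedCells (fun n => ω n a) b q c) σ i = ∅} ⊆
      ⋃ i, ⋃ f, F i f := by
    rintro a ⟨σ, i₀, hi₀⟩
    by_contra hno
    simp only [Set.mem_iUnion, not_exists] at hno
    have key : ∀ i,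
        L i ≤ (cellTree b q g j₀ (retainedCells (fun n => ω n a) b q c) σ i).card := by
      intro i
      induction i with
      | zero =>
        simp only [L, cellTree, card_gridIndex]
        simp
      | succ i ih =>
        let f : Fin ((i + 1) / g) → Fin 2 := fun k => σ k
        have hf : ∀ k < (i + 1) / g, σ k = extendWord f k := fun k hk => by
          rw [extendWord, dif_pos hk]
        have h1 := hno i f
        simp only [F, Set.mem_ofPred_eq, not_and, not_lt] at h1
        rw [← hLsucc, ← cellTree_congr hf, ← cellTree_congr fun k hk =>
          hf k (hk.trans_le (Nat.div_le_div_right (Nat.le_succ i)))] at h1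
        exact h1 ih
    have h1 := key i₀
    rw [hi₀, Finset.card_empty, Nat.cast_zero] at h1
    exact absurd h1 (not_le.2 (hLpos i₀))
  set A : ℝ := 2 * (4 * c * q + 1) ^ d / (ε ^ 2 * (q * b ^ (j₀ + 1) : ℕ) ^ d) with hA
  have hA0 : 0 ≤ A := by positivity
  have hFi : ∀ i, P (⋃ f, F i f) ≤ ENNReal.ofReal (A * (1 / β) ^ i) := fun i => by
    have h1 : ∀ f, P (F i f) ≤ ENNReal.ofReal ((4 * c * q + 1) ^ d / (ε ^ 2 * L i)) := fun f => by
      rw [← ofReal_measureReal]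
      exact ENNReal.ofReal_le_ofReal (measureReal_cellTree_drop_le hmeas hindep hunif hb hq hc hcb
        hτ0.le hε hτε j₀ (extendWord f) i (hLpos i))
    refine (measure_iUnion_fintype_le P _).trans ((Finset.sum_le_sum fun f _ => h1 f).trans ?_)
    rw [Finset.sum_const, Finset.card_univ, Fintype.card_fun, Fintype.card_fin, Fintype.card_fin,
      nsmul_eq_mul, ← ENNReal.ofReal_natCast, ← ENNReal.ofReal_mul (by positivity)]
    refine ENNReal.ofReal_le_ofReal ?_
    have h2 : (((2 : ℕ) ^ ((i + 1) / g) : ℕ) : ℝ) ≤ 2 * 2 ^ (i / g) := by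
      push_cast
      rw [← pow_succ']
      refine pow_le_pow_right₀ one_le_two ?_
      rw [Nat.succ_div]
      split_ifs <;> omega
    -- One of the two factors `β ^ i` in the population pays for the number of words and for the
    -- prescribed generations; the other leaves a summable series.
    have h3 : (2 * (b : ℝ) ^ d) ^ (i / g) ≤ β ^ i :=
      calc (2 * (b : ℝ) ^ d) ^ (i / g) ≤ (β ^ g) ^ (i / g) := by gcongr
        _ = β ^ (g * (i / g)) := by rw [← pow_mul]
        _ ≤ β ^ i := pow_le_pow_right₀ hβ.le (Nat.mul_div_le i g)
    calc _ ≤ (2 * 2 ^ (i / g)) * ((4 * c * q + 1) ^ d / (ε ^ 2 * L i)) := by gcongr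
      _ = A * ((2 * (b : ℝ) ^ d) ^ (i / g) / (β ^ 2) ^ i) := by
          simp only [L, hA, mul_pow]
          field_simp
      _ ≤ A * (β ^ i / (β ^ 2) ^ i) := by gcongr
      _ = A * (1 / β) ^ i := by
          rw [← div_pow]
          congr 2
          field_simp
  calc _ ≤ P (⋃ i, ⋃ f, F i f) := measure_mono hsub
    _ ≤ ∑' i, P (⋃ f, F i f) := measure_iUnion_le _
    _ ≤ ∑' i, ENNReal.ofReal (A * (1 / β) ^ i) := ENNReal.tsum_le_tsum hFi
    _ = ENNReal.ofReal (A * (1 - 1 / β)⁻¹) := by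
        have h1 : (1 : ℝ) / β < 1 := by rwa [div_lt_one hβ0]
        rw [← ENNReal.ofReal_tsum_of_nonneg (fun i => by positivity)
          ((summable_geometric_of_lt_one (by positivity) h1).mul_left A), tsum_mul_left,
          tsum_geometric_of_lt_one (by positivity) h1]

end RandomTree

/-! ### Large `c`: limit points are covered, and the choice of parameters. -/

/-- For `N` between consecutive powers `j` and `j + 1` of `b ^ d`, a point of block `j` has already
appeared and the radius is at least `c / b ^ (j + 1)`, the scale at which cells of level `j` were
tested. Generation 0 is untested, so `N` starts at exponent `j₀ + 1`. -/
lemma mem_uniformCoveringSet_of_cellTree {d b q g j₀ : ℕ} (hd : 1 ≤ d) (hb : 4 ≤ b) (hq : 0 < q)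
    {x : ℕ+ → UnitAddTorus (Fin d)} {c c' : ℝ} (hc0 : 0 ≤ c) (hc : c' + 1 / (2 * q) ≤ c)
    {σ : ℕ → Fin 2} {y : UnitAddTorus (Fin d)}
    (hy : ∀ i, ∃ v ∈ cellTree b q g j₀ (retainedCells x b q c') σ i,
      dist y (gridPoint (q * b ^ (j₀ + i + 1)) v) ≤ 1 / (2 * (q * b ^ (j₀ + i + 1) : ℕ))) :
    y ∈ uniformCoveringSet x fun n => c / (n : ℝ) ^ (1 / (d : ℝ)) := by
  have hB : 1 < b ^ d := Nat.one_lt_pow (by omega) (by omega)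
  have hb0 : (0 : ℝ) < b := by positivity
  change ∀ᶠ N : ℕ+ in atTop, _
  filter_upwards [eventually_ge_atTop ⟨(b ^ d) ^ (j₀ + 1), by positivity⟩] with N hN
  have hN' : (b ^ d) ^ (j₀ + 1) ≤ (N : ℕ) := hN
  have hlog1 : j₀ + 1 ≤ Nat.log (b ^ d) N := Nat.le_log_of_pow_le hB hN'
  obtain ⟨i, hi⟩ : ∃ i, Nat.log (b ^ d) N = j₀ + (i + 1) :=
    ⟨Nat.log (b ^ d) N - (j₀ + 1), by omega⟩
  have h1 : (b ^ d) ^ (j₀ + (i + 1)) ≤ (N : ℕ) := hi ▸ Nat.pow_log_le_self _ N.pos.ne'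
  have h2 : (N : ℕ) ≤ (b ^ d) ^ (j₀ + (i + 1) + 1) := hi ▸ (Nat.lt_pow_succ_log_self hB N).le
  obtain ⟨v, hv, hyv⟩ := hy (i + 1)
  obtain ⟨n, hn, hnv⟩ := (mem_cellTree_succ.1 hv).2
  refine ⟨n, ?_, ?_⟩
  · rw [← PNat.coe_le_coe]
    exact ((mem_block (by omega)).1 hn).1.trans h1
  · have h3 : c / (b : ℝ) ^ (j₀ + (i + 1) + 1) ≤ c / (N : ℝ) ^ (1 / (d : ℝ)) := by
      rw [← div_rpow_natCast_pow hd c]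
      have : ((N : ℕ) : ℝ) ≤ ((b ^ d) ^ (j₀ + (i + 1) + 1) : ℕ) := by exact_mod_cast h2
      have hNpos : (0 : ℝ) < ((N : ℕ) : ℝ) := by exact_mod_cast N.pos
      gcongr
    refine lt_of_lt_of_le ?_ h3
    have h4 := dist_triangle_right (x n) y (gridPoint (q * b ^ (j₀ + (i + 1) + 1)) v)
    have h5 : (1 : ℝ) / (2 * (q * b ^ (j₀ + (i + 1) + 1) : ℕ)) =
        1 / (2 * q) / (b : ℝ) ^ (j₀ + (i + 1) + 1) := by
      push_cast
      field_simp
    have h6 : (c' + 1 / (2 * q)) / (b : ℝ) ^ (j₀ + (i + 1) + 1) ≤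
        c / (b : ℝ) ^ (j₀ + (i + 1) + 1) := by gcongr
    rw [add_div] at h6
    linarith

open scoped Topology in
theorem ae_dimH_uniformCoveringSet_pos {Ω : Type*} [MeasurableSpace Ω] {P : Measure Ω}
    [IsProbabilityMeasure P] {d : ℕ} (hd : 1 ≤ d) {ω : ℕ+ → Ω → UnitAddTorus (Fin d)}
    (hmeas : ∀ n, Measurable (ω n)) (hindep : iIndepFun ω P)
    (hunif : ∀ n, P.map (ω n) = volume) {c : ℝ} (hc : 1 / 2 < c) :
    ∀ᵐ a ∂P, 0 < dimH (uniformCoveringSet (fun n => ω n a)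
      (fun n => c / (n : ℝ) ^ (1 / (d : ℝ)))) := by
  have hd0 : d ≠ 0 := by omega
  obtain ⟨q, hq, hqc⟩ : ∃ q : ℕ, 0 < q ∧ 1 / (2 * (q : ℝ)) < c - 1 / 2 := by
    obtain ⟨q, hq⟩ := exists_nat_one_div_lt (sub_pos.2 hc)
    refine ⟨q + 1, q.succ_pos, lt_of_le_of_lt ?_ hq⟩
    push_cast
    gcongr
    linarith [(Nat.cast_nonneg q : (0 : ℝ) ≤ q)]
  obtain ⟨c', hc'⟩ : ∃ c', c' = c - 1 / (2 * (q : ℝ)) := ⟨_, rfl⟩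
  have hc'2 : 1 / 2 < c' := by linarith
  have hc'0 : 0 < c' := by linarith
  have hκ : 1 < (2 * c') ^ d := one_lt_pow₀ (by linarith) hd0
  set κ := (2 * c') ^ d with hκdef
  have hκ0 : 0 < κ := by linarith
  -- The three conditions: `4 ≤ b` separates the digits 0 and 2, `2 * c' ≤ b` keeps the radii at
  -- most `1 / 2`, and the last gives `κ * (B - 1) ^ 2 > B ^ 2`, that is, `p > 1 / B`.
  obtain ⟨b, hb, hcb, hbκ⟩ : ∃ b : ℕ, 4 ≤ b ∧ 2 * c' ≤ b ∧ 2 * κ / (κ - 1) < b := by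
    obtain ⟨b₀, hb₀⟩ := exists_nat_gt (max 4 (max (2 * c') (2 * κ / (κ - 1))))
    rw [max_lt_iff, max_lt_iff] at hb₀
    exact ⟨b₀, by exact_mod_cast hb₀.1.le, hb₀.2.1.le, hb₀.2.2⟩
  have hb1 : (1 : ℝ) ≤ b := by exact_mod_cast (by omega : 1 ≤ b)
  have hb0 : (0 : ℝ) < b := by linarith
  have hbB : (b : ℝ) ≤ (b : ℝ) ^ d := le_self_pow₀ hb1 hd0
  obtain ⟨B, hB⟩ : ∃ B, B = (b : ℝ) ^ d := ⟨_, rfl⟩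
  have hB4 : 4 ≤ B := by
    rw [hB]
    exact le_trans (by exact_mod_cast hb) hbB
  have hB0 : 0 < B := by linarith
  obtain ⟨p, hp⟩ : ∃ p, p = κ * (1 - 1 / B) / B / (1 + κ * (1 - 1 / B) / B) := ⟨_, rfl⟩
  have hpB : 1 / B < p := by
    have h1 : 2 * κ < B * (κ - 1) := by
      rw [div_lt_iff₀ (by linarith)] at hbκ
      rw [hB]
      nlinarith
    have h2 : 0 ≤ κ * (1 - 1 / B) / B := by
      have : 1 / B ≤ 1 := by
        rw [div_le_one hB0]
        linarith
      have : 0 ≤ 1 - 1 / B := by linarith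
      positivity
    have e : κ * (1 - 1 / B) / B = κ * (B - 1) / B ^ 2 := by field_simp
    rw [e] at h2 hp
    rw [hp, div_lt_div_iff₀ hB0 (by positivity), ← sub_pos]
    have e3 : κ * (B - 1) / B ^ 2 * B - 1 * (1 + κ * (B - 1) / B ^ 2) =
        (κ * (B - 1) ^ 2 - B ^ 2) / B ^ 2 := by
      field_simp
      ring
    rw [e3]
    refine div_pos ?_ (by positivity)
    nlinarith
  -- `τ` is the midpoint of `1 / B` and `p`, and `ε` half the gap: growth `B * τ > 1` is kept while
  -- `τ + ε = p`.
  obtain ⟨τ, hτ⟩ : ∃ τ, τ = (p + 1 / B) / 2 := ⟨_, rfl⟩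
  obtain ⟨ε, hε⟩ : ∃ ε, ε = (p - 1 / B) / 2 := ⟨_, rfl⟩
  have hε0 : 0 < ε := by linarith
  have hτB : 1 < B * τ := by
    have : 1 / B < τ := by linarith
    rw [div_lt_iff₀ hB0] at this
    linarith
  obtain ⟨β, hβ⟩ : ∃ β, β = √(B * τ) := ⟨_, rfl⟩
  have hβ1 : 1 < β := by
    rw [hβ, Real.lt_sqrt (by norm_num)]
    linarith
  have hβ2 : β ^ 2 = B * τ := by rw [hβ, Real.sq_sqrt (by linarith)]
  obtain ⟨g, hg⟩ := pow_unbounded_of_one_lt (2 * B) hβ1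
  have hg0 : 0 < g := by
    rcases Nat.eq_zero_or_pos g with rfl | h
    · rw [pow_zero] at hg
      linarith
    · exact h
  have hbad := measure_exists_cellTree_eq_empty_le (g := g) hmeas hindep hunif hb hq hc'0 hcb hε0
    (τ := τ) (by rw [← hB, ← hκdef, ← hp]; linarith) hβ1 (by rw [← hB]; exact hβ2)
    (by rw [← hB]; exact hg.le)
  have hlim : Tendsto (fun j₀ : ℕ => ENNReal.ofReal (2 * (4 * c' * q + 1) ^ d /
      (ε ^ 2 * (q * b ^ (j₀ + 1) : ℕ) ^ d) * (1 - 1 / β)⁻¹)) atTop (𝓝 0) := by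
    rw [← ENNReal.ofReal_zero, ← zero_mul (1 - 1 / β)⁻¹]
    refine ENNReal.tendsto_ofReal (Tendsto.mul_const _ (Tendsto.const_div_atTop ?_ _))
    refine Tendsto.const_mul_atTop (by positivity) ((tendsto_pow_atTop hd0).comp ?_)
    refine tendsto_natCast_atTop_atTop.comp ?_
    refine tendsto_atTop_mono (fun j => ?_) tendsto_id
    have h1 : j + 1 < b ^ (j + 1) := Nat.lt_pow_self (by omega)
    exact le_trans (by simp only [id]; omega) (Nat.le_mul_of_pos_left _ hq)
  -- The failure probabilities tend to 0 as the starting level grows, so almost surely some starting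
  -- level succeeds.
  have hnull : P (⋂ j₀, {a | ∃ σ i,
      cellTree b q g j₀ (retainedCells (fun n => ω n a) b q c') σ i = ∅}) = 0 :=
    le_antisymm (ge_of_tendsto' hlim fun j₀ =>
      (measure_mono (Set.iInter_subset _ j₀)).trans (hbad j₀)) zero_le
  filter_upwards [measure_eq_zero_iff_ae_notMem.1 hnull] with a ha
  simp only [Set.mem_iInter, Set.mem_ofPred_eq, not_forall, not_exists] at ha
  obtain ⟨j₀, hj₀⟩ := ha
  choose y hy using fun σ => exists_limit_point hb hq fun i =>
    Finset.nonempty_iff_ne_empty.2 (hj₀ σ i)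
  refine lt_of_lt_of_le (dimH_range_pos_of_separated y (C := 1 / ((q : ℝ) * b ^ (j₀ + g + 1)))
    (η := (1 / b : ℝ) ^ g) (by positivity) (by positivity)
    (pow_lt_one₀ (by positivity) ?_ hg0.ne') fun σ σ' k hk =>
      le_dist_of_letter_ne hd hb hq hg0 (hy σ) (hy σ') hk) (dimH_mono ?_)
  · rw [div_lt_one hb0]
    exact_mod_cast (by omega : 1 < b)
  · rintro _ ⟨σ, rfl⟩
    exact mem_uniformCoveringSet_of_cellTree hd hb hq (by linarith) (by linarith) (hy σ)

/- `UnitAddTorus (Fin d)` is `Fin d → ℝ/ℤ` with the maximum metric (each coordinate measured by the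
distance to the nearest integer); its `volume` is Lebesgue measure, of total mass one. -/
theorem mainTheorem7 {d : ℕ} (hd : 1 ≤ d)
    {Ω : Type*} [MeasurableSpace Ω] (P : Measure Ω) [IsProbabilityMeasure P]
    (ω : ℕ+ → Ω → UnitAddTorus (Fin d))
    (hmeas : ∀ n, Measurable (ω n))
    (hindep : iIndepFun ω P)
    (hunif : ∀ n, P.map (ω n) = volume)
    (c : ℝ) :
    (1 / 2 < c → ∀ᵐ a ∂P,
      0 < dimH (uniformCoveringSet (fun n => ω n a)
        (fun n => c / (n : ℝ) ^ (1 / (d : ℝ))))) ∧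
    (0 < c → c < 1 / 2 → ∀ᵐ a ∂P,
      dimH (uniformCoveringSet (fun n => ω n a)
        (fun n => c / (n : ℝ) ^ (1 / (d : ℝ)))) < (d : ENNReal)) :=
  ⟨fun hc => ae_dimH_uniformCoveringSet_pos hd hmeas hindep hunif hc,
    fun hc hc2 => ae_dimH_uniformCoveringSet_lt hd hmeas hindep hunif hc hc2⟩
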